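/- Fix the normalization $\widehat\varphi(t)=\int_{\mathbb R}\varphi(x)e^{-2\pi i t x}\,dx$ of the Fourier transform, extended to tempered distributions by $\langle\widehat\alpha,\varphi\rangle=\langle\alpha,\widehat\varphi\rangle$. A set $A\subset\mathbb R$ is called uniformly discrete if $\inf\{|x-y| : x,y\in A,\ x\ne y\}>0$. Let $$\mu=\sum_{\lambda\in\Lambda}\mu(\lambda)\,\delta_\lambda,\qquad \mu(\lambda)\in\mathbb C\setminus\{0\},$$ be a complex measure on $\mathbb R$ whose support $\Lambda\subset\mathbb R$ is uniformly discrete. Assume that $\mu$ is a tempered distribution and that its Fourier transform $\widehat\mu$ (in the sense of distributions) is also a measure, $$\widehat\mu=\sum_{s\in S}\widehat\mu(s)\,\delta_s,\qquad \widehat\mu(s)\in\mathbb C\setminus\{0\},$$ whose support $S\subset\mathbb R$ is uniformly discrete. Then there exist a (full-rank) lattice $L\subset\mathbb R$ and finite sets $F,G\subset\mathbb R$ such that $$\Lambda\subset L+F\qquad\text{and}\qquad S\subset L^*+G,$$ where $L^*=\{s\in\mathbb R : xs\in\mathbb Z\text{ for all }x\in L\}$ is the dual lattice of $L$. -/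

import Mathlib

open scoped SchwartzMap FourierTransform Pointwise

/-- A set `Λ ⊆ ℝ` is uniformly discrete if the distances between distinct points of `Λ` are bounded
below by a positive constant. -/
def IsUniformlyDiscrete (Λ : Set ℝ) : Prop :=
  ∃ d : ℝ, 0 < d ∧ ∀ x ∈ Λ, ∀ y ∈ Λ, x ≠ y → d ≤ |x - y|

/-- The tempered distribution `T` is the (complex, locally finite) measure `∑_{x ∈ Λ} c(x) δ_x`,
where `Λ` is uniformly discrete and all the masses `c(x)` are nonzero, so that `Λ` is the support of
the measure. The identity between the distribution and the measure is tested on compactly supported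
smooth functions; for these only finitely many terms of the series are nonzero. -/
structure IsDiscreteMeasure (T : 𝓢'(ℝ, ℂ)) (Λ : Set ℝ) (c : Λ → ℂ) : Prop where
  uniformlyDiscrete : IsUniformlyDiscrete Λ
  mass_ne_zero : ∀ x : Λ, c x ≠ 0
  hasSum : ∀ φ : 𝓢(ℝ, ℂ), HasCompactSupport φ → HasSum (fun x : Λ => c x * φ x) (T φ)

/-- The dual lattice `L* = {s ∈ ℝ : x s ∈ ℤ for all x ∈ L}`. -/
def dualLattice (L : Submodule ℤ ℝ) : Submodule ℤ ℝ where
  carrier := {s | ∀ x ∈ L, ∃ n : ℤ, x * s = n}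
  zero_mem' := fun x _ => ⟨0, by simp⟩
  add_mem' := by
    intro s t hs ht x hx
    obtain ⟨m, hm⟩ := hs x hx
    obtain ⟨n, hn⟩ := ht x hx
    exact ⟨m + n, by rw [mul_add, hm, hn]; push_cast; rfl⟩
  smul_mem' := by
    intro k s hs x hx
    obtain ⟨m, hm⟩ := hs x hx
    exact ⟨k * m, by rw [zsmul_eq_mul, mul_left_comm, hm]; push_cast; rfl⟩

/-! The work lies in the structure of `Λ`; the spectrum then follows by algebra. Let `S` be
`δ`-separated and let `φ` be supported in `(δ/4, 3δ/4)`. Nonzero points of `S - S` have modulus at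
least `δ`, so the transform of the measure with masses `a x * 𝓕 φ x` vanishes within `δ/8` of `S`.
Translates of `μ` have their spectrum in `S`, so multiplying this measure by the conjugate of a
smoothed translate of `μ` gives a transform vanishing on `[-δ/8, δ/8]`. Letting the smoothing
shrink, for every `h` the finite measure with masses `a x * 𝓕 φ x * conj (a (x + h))`, which lives
on `Λ ∩ (Λ - h)`, has a spectral gap (`IsDiscreteMeasure.spectrumVanishes_correlation`).

A nonzero finite measure with separated support and a spectral gap has support of lower density at
least some `c > 0` depending only on the separation and the gap
(`exists_density_of_spectrumVanishes`): on a sparser support, multipliers of small bandwidth would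
isolate a single mass. Hence every difference of `Λ` recurs with density bounded below uniformly.

Such recurrence makes `Λ + (Λ - Λ)` translation bounded. As `Λ` is also relatively dense, by Poisson
summation, the group it generates is finitely generated, and on `Λ` each integer coordinate of this
group is within bounded distance of a linear function. The deviations take finitely many values on
`Λ - Λ` (`HasDenseDifferences.finite_image`), and the subgroup where all deviations vanish is
discrete, so `Λ` meets finitely many cosets of some `αℤ` (`HasDenseDifferences.exists_lattice`).

Then `exp (2πi x / α)` takes finitely many values on `Λ`, so a polynomial in it annihilates `μ`. On
the Fourier side this is a linear recurrence of step `1/α`, which brings every point of `S`, modulo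
`1/α`, into a bounded and hence finite part of `S`. -/

open Filter Topology
open scoped ContDiff

/-! ### Counting points of separated and translation bounded sets -/

/-- A `d`-separated finite set contained in an interval of length `L` has at most `L / d + 1`
points. -/
lemma card_mul_le_of_separated {d L x : ℝ} (hd : 0 < d) (hL : 0 ≤ L) {s : Finset ℝ}
    (hs : ∀ y ∈ s, x ≤ y ∧ y ≤ x + L)
    (hsep : ∀ y ∈ s, ∀ z ∈ s, y ≠ z → d ≤ |y - z|) : (s.card : ℝ) * d ≤ L + d := by
  have h1 : s.card ≤ (Finset.range (⌊L / d⌋₊ + 1)).card := by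
    refine Finset.card_le_card_of_injOn (fun y => ⌊(y - x) / d⌋₊) ?_ ?_
    · intro y hy
      obtain ⟨h1, h2⟩ := hs y hy
      simp only [Finset.coe_range, Set.mem_Iio, Nat.lt_succ_iff]
      exact Nat.floor_le_floor (by gcongr; linarith)
    · intro y hy z hz hyz
      by_contra hne
      have h3 := hsep y hy z hz hne
      have hy0 : 0 ≤ (y - x) / d := div_nonneg (by linarith [(hs y hy).1]) hd.le
      have hz0 : 0 ≤ (z - x) / d := div_nonneg (by linarith [(hs z hz).1]) hd.le
      have a1 := Nat.floor_le hy0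
      have a2 := Nat.lt_floor_add_one ((y - x) / d)
      have b1 := Nat.floor_le hz0
      have b2 := Nat.lt_floor_add_one ((z - x) / d)
      simp only at hyz
      rw [hyz] at a1 a2
      have h4 : |(y - x) / d - (z - x) / d| < 1 := by rw [abs_lt]; constructor <;> linarith
      rw [← sub_div, abs_div, abs_of_pos hd, div_lt_one hd] at h4
      have : y - x - (z - x) = y - z := by ring
      rw [this] at h4
      linarith
  rw [Finset.card_range] at h1
  have h2 : (s.card : ℝ) ≤ L / d + 1 := by
    calc (s.card : ℝ) ≤ ((⌊L / d⌋₊ + 1 : ℕ) : ℝ) := by exact_mod_cast h1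
      _ ≤ L / d + 1 := by push_cast; gcongr; exact Nat.floor_le (by positivity)
  calc (s.card : ℝ) * d ≤ (L / d + 1) * d := by gcongr
    _ = L + d := by field_simp

/-- `X` is translation bounded at scale `ℓ`: the number of its points in intervals of length `ℓ` is
bounded. -/
def TranslationBounded (X : Set ℝ) (ℓ : ℝ) : Prop :=
  ∃ K : ℕ, ∀ (x : ℝ) (s : Finset ℝ), (∀ y ∈ s, y ∈ X ∧ x ≤ y ∧ y ≤ x + ℓ) → s.card ≤ K

lemma TranslationBounded.finset_bound {X : Set ℝ} {ℓ : ℝ} (h : TranslationBounded X ℓ)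
    (hℓ : 0 < ℓ) : ∃ K : ℕ, ∀ (n : ℕ) (x : ℝ) (s : Finset ℝ),
      (∀ y ∈ s, y ∈ X ∧ x ≤ y ∧ y ≤ x + n * ℓ) → s.card ≤ (n + 1) * K := by
  obtain ⟨K, hK⟩ := h
  refine ⟨K, fun n => ?_⟩
  induction n with
  | zero =>
    intro x s hs
    simpa using hK x s fun y hy => ⟨(hs y hy).1, (hs y hy).2.1, by
      have := (hs y hy).2.2; simp at this; linarith⟩
  | succ n ih =>
    intro x s hs
    classical
    rw [← Finset.card_filter_add_card_filter_not (fun y => y ≤ x + n * ℓ)]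
    have h1 := ih x (s.filter fun y => y ≤ x + n * ℓ) (by
      intro y hy
      rw [Finset.mem_filter] at hy
      exact ⟨(hs y hy.1).1, (hs y hy.1).2.1, hy.2⟩)
    have h2 := hK (x + n * ℓ) (s.filter fun y => ¬ y ≤ x + n * ℓ) (by
      intro y hy
      rw [Finset.mem_filter] at hy
      refine ⟨(hs y hy.1).1, by linarith [hy.2], ?_⟩
      have := (hs y hy.1).2.2
      push_cast at this
      linarith)
    calc _ ≤ (n + 1) * K + K := add_le_add h1 h2
      _ = _ := by ring

lemma TranslationBounded.of_pos {X : Set ℝ} {ℓ ℓ' : ℝ} (h : TranslationBounded X ℓ)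
    (hℓ : 0 < ℓ) : TranslationBounded X ℓ' := by
  obtain ⟨K, hK⟩ := h.finset_bound hℓ
  refine ⟨(⌈ℓ' / ℓ⌉₊ + 1) * K, fun x s hs => hK _ x s fun y hy => ⟨(hs y hy).1, (hs y hy).2.1, ?_⟩⟩
  have : ℓ' ≤ ⌈ℓ' / ℓ⌉₊ * ℓ := by rw [← div_le_iff₀ hℓ]; exact Nat.le_ceil _
  linarith [(hs y hy).2.2]

lemma TranslationBounded.finite_inter {X : Set ℝ} {ℓ : ℝ} (h : TranslationBounded X ℓ)
    (hℓ : 0 < ℓ) (R : ℝ) : (X ∩ Set.Icc (-R) R).Finite := by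
  obtain ⟨K, hK⟩ := h.of_pos hℓ (ℓ' := 2 * R)
  by_contra hinf
  obtain ⟨t, ht, hc⟩ := Set.Infinite.exists_subset_card_eq hinf (K + 1)
  have := hK (-R) t fun y hy => by
    obtain ⟨h1, h2⟩ := ht hy
    exact ⟨h1, h2.1, by linarith [h2.2]⟩
  omega

lemma TranslationBounded.linear_growth {X : Set ℝ} {ℓ : ℝ} (h : TranslationBounded X ℓ)
    (hℓ : 0 < ℓ) : ∃ C : ℝ, 0 < C ∧ ∀ R : ℝ, 1 ≤ R → ∀ s : Finset ℝ,
      (∀ y ∈ s, y ∈ X ∧ |y| ≤ R) → (s.card : ℝ) ≤ C * R := by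
  obtain ⟨K, hK⟩ := h.finset_bound hℓ
  refine ⟨(2 / ℓ + 2) * (K + 1), by positivity, fun R hR s hs => ?_⟩
  have h1 := hK ⌈2 * R / ℓ⌉₊ (-R) s fun y hy => by
    obtain ⟨h1, h2⟩ := hs y hy
    rw [abs_le] at h2
    have : 2 * R ≤ ⌈2 * R / ℓ⌉₊ * ℓ := by rw [← div_le_iff₀ hℓ]; exact Nat.le_ceil _
    exact ⟨h1, h2.1, by linarith⟩
  have h2 : (⌈2 * R / ℓ⌉₊ : ℝ) < 2 * R / ℓ + 1 := Nat.ceil_lt_add_one (by positivity)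
  calc (s.card : ℝ) ≤ (((⌈2 * R / ℓ⌉₊ + 1) * K : ℕ) : ℝ) := by exact_mod_cast h1
    _ ≤ (2 * R / ℓ + 2) * (K + 1) := by
        push_cast
        apply mul_le_mul <;> first | positivity | linarith
    _ ≤ (2 / ℓ + 2) * (K + 1) * R := by
        have : 2 * R / ℓ + 2 ≤ (2 / ℓ + 2) * R := by
          have : 2 * R / ℓ = 2 / ℓ * R := by ring
          rw [this]; nlinarith
        nlinarith [this, (Nat.cast_nonneg K : (0 : ℝ) ≤ K)]

lemma IsUniformlyDiscrete.translationBounded {Λ : Set ℝ} (h : IsUniformlyDiscrete Λ) :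
    TranslationBounded Λ 1 := by
  obtain ⟨d, hd, hsep⟩ := h
  refine ⟨⌊1 / d + 1⌋₊, fun x s hs => ?_⟩
  have := card_mul_le_of_separated hd zero_le_one (fun y hy => (hs y hy).2)
    (fun y hy z hz => hsep y (hs y hy).1 z (hs z hz).1)
  apply Nat.le_floor
  rw [div_add_one hd.ne', le_div_iff₀ hd]
  exact this

/-! ### Sets whose differences recur with positive density -/

/-- Every difference of two points of `Λ` occurs with lower density at least `c`. -/
def HasDenseDifferences (Λ : Set ℝ) (c : ℝ) : Prop :=
  ∀ x ∈ Λ, ∀ y ∈ Λ, ∀ᶠ R : ℝ in atTop, ∃ s : Finset ℝ,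
    (∀ z ∈ s, z ∈ Λ ∧ z + (y - x) ∈ Λ ∧ |z| ≤ R) ∧ c * R ≤ s.card

section Differences

variable {Λ : Set ℝ} {c : ℝ}

/-- Distinct differences `u`, `v` at distance at most `d / 2` cannot start at the same point `z`,
since `z + u` and `z + v` would be too close in `Λ`. So nearby differences claim disjoint subsets of
`Λ`, each of density `c`, and only boundedly many fit. -/
lemma HasDenseDifferences.translationBounded_sub (h : HasDenseDifferences Λ c) (hc : 0 < c)
    (hΛ : IsUniformlyDiscrete Λ) : TranslationBounded (Λ - Λ) 1 := by
  obtain ⟨C, hC, hgrow⟩ := hΛ.translationBounded.linear_growth one_pos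
  obtain ⟨d, hd, hsep⟩ := hΛ
  suffices TranslationBounded (Λ - Λ) (d / 2) from this.of_pos (by positivity)
  refine ⟨⌊C / c⌋₊, fun x s hs => ?_⟩
  apply Nat.le_floor
  have hev : ∀ᶠ R : ℝ in atTop, ∀ h ∈ s, ∃ t : Finset ℝ,
      (∀ z ∈ t, z ∈ Λ ∧ z + h ∈ Λ ∧ |z| ≤ R) ∧ c * R ≤ t.card := by
    rw [eventually_all_finset]
    intro u hu
    obtain ⟨y, hy, z, hz, rfl⟩ := (hs u hu).1
    exact h z hz y hy
  obtain ⟨R, hR, hR1⟩ := (hev.and (eventually_ge_atTop 1)).exists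
  choose! t ht htc using hR
  classical
  have hdisj : (s : Set ℝ).PairwiseDisjoint t := by
    intro u hu v hv huv
    rw [Function.onFun, Finset.disjoint_left]
    intro z hzu hzv
    have h1 := hsep _ (ht u hu z hzu).2.1 _ (ht v hv z hzv).2.1 (by simpa using huv)
    have h2 : |z + u - (z + v)| ≤ d / 2 := by
      obtain ⟨-, a1, a2⟩ := hs u hu
      obtain ⟨-, b1, b2⟩ := hs v hv
      rw [abs_le]; constructor <;> linarith
    linarith
  have h3 := hgrow R hR1 (s.biUnion t) fun y hy => by
    obtain ⟨u, hu, hyu⟩ := Finset.mem_biUnion.1 hy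
    exact ⟨(ht u hu y hyu).1, (ht u hu y hyu).2.2⟩
  rw [Finset.card_biUnion hdisj, Nat.cast_sum] at h3
  have h4 : (s.card : ℝ) * (c * R) ≤ C * R := by
    calc (s.card : ℝ) * (c * R) = ∑ u ∈ s, c * R := by simp
      _ ≤ _ := Finset.sum_le_sum htc
      _ ≤ _ := h3
  rw [le_div_iff₀ hc]
  have hR0 : 0 < R := by linarith
  rw [← mul_assoc] at h4
  exact le_of_mul_le_mul_right h4 hR0

/-- Double counting of pairs `y`, `z` with `z ∈ Λ` and `y - z ∈ Λ - Λ`. Each `y` has many partners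
because its difference recurs; each `z` has few because `Λ - Λ` is translation bounded. -/
lemma HasDenseDifferences.translationBounded_add_sub (h : HasDenseDifferences Λ c) (hc : 0 < c)
    (hΛ : IsUniformlyDiscrete Λ) : TranslationBounded (Λ + (Λ - Λ)) 1 := by
  obtain ⟨C, hC, hgrow⟩ := hΛ.translationBounded.linear_growth one_pos
  obtain ⟨K, hK⟩ := h.translationBounded_sub hc hΛ
  refine ⟨⌊2 * C * K / c⌋₊, fun x s hs => ?_⟩
  apply Nat.le_floor
  have hev : ∀ᶠ R : ℝ in atTop, ∀ y ∈ s, ∃ t : Finset ℝ,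
      (∀ z ∈ t, z ∈ Λ ∧ y - z ∈ Λ - Λ ∧ |z| ≤ 2 * R) ∧ c * R ≤ t.card := by
    rw [eventually_all_finset]
    intro u hu
    obtain ⟨y, hy, -, ⟨z, hz, w, hw, rfl⟩, rfl⟩ := (hs u hu).1
    filter_upwards [h w hw z hz, eventually_ge_atTop |z - w|] with R ⟨t, ht, htc⟩ hR
    -- If `v'` and `v = v' + (z - w)` lie in `Λ`, then `y + (z - w) - v = y - v'` lies in `Λ - Λ`.
    -- The shift by `z - w` is why the radius is doubled.
    refine ⟨t.map (addRightEmbedding (z - w)), ?_, by simpa using htc⟩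
    intro v hv
    obtain ⟨v', hv', rfl⟩ := Finset.mem_map.1 hv
    obtain ⟨h1, h2, h3⟩ := ht v' hv'
    refine ⟨h2, ⟨y, hy, v', h1, by simp⟩, ?_⟩
    calc |v' + (z - w)| ≤ |v'| + |z - w| := abs_add_le _ _
      _ ≤ 2 * R := by linarith
  obtain ⟨R, hR, hR1⟩ := (hev.and (eventually_ge_atTop 1)).exists
  choose! t ht htc using hR
  classical
  let A : Finset ℝ := s.biUnion t
  have hA := hgrow (2 * R) (by linarith) A fun y hy => by
    obtain ⟨u, hu, hyu⟩ := Finset.mem_biUnion.1 hy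
    exact ⟨(ht u hu y hyu).1, (ht u hu y hyu).2.2⟩
  have key : s.card * ⌈c * R⌉₊ ≤ A.card * K := by
    refine Finset.card_mul_le_card_mul (fun y z => y - z ∈ Λ - Λ) ?_ ?_
    · intro y hy
      refine (Nat.ceil_le.2 (htc y hy)).trans (Finset.card_le_card ?_)
      intro z hz
      rw [Finset.mem_bipartiteAbove]
      exact ⟨Finset.mem_biUnion.2 ⟨y, hy, hz⟩, (ht y hy z hz).2.1⟩
    · intro z _
      have := hK (x - z) ((Finset.bipartiteBelow (fun y z => y - z ∈ Λ - Λ) s z).map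
          (addRightEmbedding (-z))) fun u hu => by
        obtain ⟨y, hy, rfl⟩ := Finset.mem_map.1 hu
        rw [Finset.mem_bipartiteBelow] at hy
        obtain ⟨-, h1, h2⟩ := hs y hy.1
        simp only [addRightEmbedding_apply, ← sub_eq_add_neg]
        exact ⟨hy.2, by linarith, by linarith⟩
      simpa using this
  have key' : (s.card : ℝ) * (c * R) ≤ C * (2 * R) * K := by
    calc (s.card : ℝ) * (c * R) ≤ s.card * ⌈c * R⌉₊ := by gcongr; exact Nat.le_ceil _
      _ ≤ A.card * K := by exact_mod_cast key
      _ ≤ _ := by gcongr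
  rw [le_div_iff₀ hc]
  have hR0 : 0 < R := by linarith
  refine le_of_mul_le_mul_right ?_ hR0
  linarith

end Differences

/-! ### Quasimorphisms and linear approximation -/

/-- An approximately additive function on `ℝ` which is bounded on `[0, 1]` is at bounded distance
from a linear function. -/
lemma exists_linear_approx_of_quasimorphism {f : ℝ → ℝ} {C B : ℝ}
    (hf : ∀ x y, |f (x + y) - f x - f y| ≤ C) (hB : ∀ x, 0 ≤ x → x ≤ 1 → |f x| ≤ B) :
    ∃ a C', ∀ x, |f x - a * x| ≤ C' := by
  have hC : 0 ≤ C := (abs_nonneg _).trans (hf 0 0)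
  -- Adding `C` makes `f` subadditive on the naturals; the slope `a` is its Fekete limit.
  have hsub : Subadditive fun n : ℕ => f n + C := fun m n => by
    have := (abs_le.1 (hf m n)).2
    push_cast
    linarith
  have hmul : ∀ (x : ℝ) (n : ℕ), |f ((n + 1 : ℕ) * x) - (n + 1 : ℕ) * f x| ≤ n * C := by
    intro x n
    induction n with
    | zero => simp
    | succ n ih =>
      have h1 := hf ((n + 1 : ℕ) * x) x
      have e : ((n + 1 : ℕ) : ℝ) * x + x = ((n + 1 + 1 : ℕ) : ℝ) * x := by push_cast; ring
      rw [e] at h1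
      rw [abs_le] at *
      push_cast at *
      constructor <;> nlinarith [ih.1, ih.2, h1.1, h1.2]
  have hlin : ∀ n : ℕ, |f n| ≤ (n + 1) * (C + |f 1|) + |f 0| := by
    intro n
    rcases n with _ | n
    · simp; positivity
    · have := hmul 1 n
      rw [mul_one] at this
      have h2 : |f (n + 1 : ℕ)| ≤ n * C + (n + 1) * |f 1| := by
        calc |f (n + 1 : ℕ)| = |(f (n + 1 : ℕ) - (n + 1 : ℕ) * f 1) + (n + 1 : ℕ) * f 1| := by
              ring_nf
          _ ≤ n * C + |(n + 1 : ℕ) * f 1| := (abs_add_le _ _).trans (by gcongr)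
          _ = _ := by rw [abs_mul, Nat.abs_cast]; push_cast; ring
      push_cast at *
      nlinarith [abs_nonneg (f 0), abs_nonneg (f 1)]
  have hbdd : BddBelow (Set.range fun n : ℕ => (f n + C) / n) := by
    refine ⟨-(2 * (C + |f 1|) + |f 0|), ?_⟩
    rintro _ ⟨n, rfl⟩
    rcases Nat.eq_zero_or_pos n with rfl | hn
    · simp only [Nat.cast_zero, div_zero]
      linarith [abs_nonneg (f 0), abs_nonneg (f 1)]
    · have hn' : (1 : ℝ) ≤ n := by exact_mod_cast hn
      rw [le_div_iff₀ (by linarith)]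
      have := (abs_le.1 (hlin n)).1
      nlinarith [abs_nonneg (f 0), abs_nonneg (f 1)]
  have hlim := hsub.tendsto_lim hbdd
  set a := hsub.lim with ha
  have hnat : ∀ m : ℕ, |f m - a * m| ≤ C := by
    intro m
    rcases Nat.eq_zero_or_pos m with rfl | hm
    · have := hf 0 0
      rw [abs_le] at *
      simp at *
      constructor <;> linarith [this.1, this.2]
    have hm' : (0 : ℝ) < m := by exact_mod_cast hm
    have h1 : Tendsto (fun n : ℕ => (f (((n + 1) * m : ℕ)) + C) / ((n + 1) * m : ℕ)) atTop (𝓝 a) :=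
      hlim.comp ((tendsto_id.atTop_mul_const' hm).comp (tendsto_add_atTop_nat 1))
    have h2 : Tendsto (fun n : ℕ => ((f (((n + 1) * m : ℕ)) + C) / ((n + 1) * m : ℕ)) * m - f m
        - C * (1 / ((n : ℝ) + 1))) atTop (𝓝 (a * m - f m - C * 0)) :=
      ((h1.mul_const _).sub_const _).sub (tendsto_one_div_add_atTop_nhds_zero_nat.const_mul C)
    have h3 : ∀ n : ℕ, |((f (((n + 1) * m : ℕ)) + C) / ((n + 1) * m : ℕ)) * m - f m
        - C * (1 / ((n : ℝ) + 1))| ≤ C := by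
      intro n
      have h4 := hmul m n
      have hn : (0 : ℝ) < n + 1 := by positivity
      have e : ((f (((n + 1) * m : ℕ)) + C) / ((n + 1) * m : ℕ)) * m - f m
        - C * (1 / ((n : ℝ) + 1)) = (f ((n + 1 : ℕ) * m) - (n + 1 : ℕ) * f m) / (n + 1) := by
        push_cast
        field_simp
        ring
      rw [e, abs_div, abs_of_pos hn, div_le_iff₀ hn]
      nlinarith
    have h5 := le_of_tendsto h2.abs (Eventually.of_forall h3)
    rw [abs_sub_comm]
    simpa using h5
  have hpos : ∀ x : ℝ, 0 ≤ x → |f x - a * x| ≤ 2 * C + B + |a| := by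
    intro x hx
    have h1 := hf ⌊x⌋₊ (x - ⌊x⌋₊)
    have h2 := hnat ⌊x⌋₊
    have h4 := Nat.floor_le hx
    have h5 := Nat.lt_floor_add_one x
    have h3 := hB (x - ⌊x⌋₊) (by linarith) (by linarith)
    have h6 : |a * (x - ⌊x⌋₊)| ≤ |a| := by
      rw [abs_mul]
      refine mul_le_of_le_one_right (abs_nonneg _) ?_
      rw [abs_le]; constructor <;> linarith
    rw [add_sub_cancel] at h1
    rw [abs_le] at h1 h2 h3 h6
    have := abs_nonneg a
    rw [abs_le]
    constructor <;> nlinarith [h1.1, h1.2, h2.1, h2.2, h3.1, h3.2, h6.1, h6.2]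
  refine ⟨a, (2 * C + B + |a|) + C + |f 0|, fun x => ?_⟩
  rcases le_total 0 x with hx | hx
  · exact (hpos x hx).trans (by linarith [abs_nonneg (f 0)])
  · have h1 := hpos (-x) (by linarith)
    have h2 := hf x (-x)
    rw [add_neg_cancel] at h2
    have h3 := abs_le.1 (le_refl |f 0|)
    rw [abs_le] at h1 h2 ⊢
    constructor <;> linarith [h1.1, h1.2, h2.1, h2.2, h3.1, h3.2]

section Differences

variable {Λ : Set ℝ} {c : ℝ}

/-- Every point of the line is within distance `R` of `Λ`. -/
def IsRelativelyDense (Λ : Set ℝ) (R : ℝ) : Prop :=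
  ∀ x, ∃ y ∈ Λ, |y - x| ≤ R

lemma exists_abs_le_of_finite {X : Set ℝ} (hX : X.Finite) (f : ℝ → ℝ) :
    ∃ C, ∀ x ∈ X, |f x| ≤ C := by
  obtain ⟨C, hC⟩ := (hX.image fun x => |f x|).bddAbove
  exact ⟨C, fun x hx => hC ⟨x, hx, rfl⟩⟩

/-- Lagarias' linear approximation of the address map. -/
lemma exists_linear_approx {ℓ R : ℝ} (hR : IsRelativelyDense Λ R) (hℓ : 0 < ℓ)
    (h : TranslationBounded (Λ + (Λ - Λ)) ℓ) (ψ : ℝ →+ ℝ) :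
    ∃ a C, ∀ x ∈ Λ, |ψ x - a * x| ≤ C := by
  have hR0 : 0 ≤ R := (abs_nonneg _).trans (hR 0).choose_spec.2
  obtain ⟨C₁, hC₁⟩ := exists_abs_le_of_finite (h.finite_inter hℓ (3 * R)) ψ
  have hself : ∀ x ∈ Λ, x ∈ Λ + (Λ - Λ) := fun x hx => ⟨x, hx, 0, ⟨x, hx, x, hx, sub_self x⟩, add_zero x⟩
  obtain ⟨C₂, hC₂⟩ := exists_abs_le_of_finite (h.finite_inter hℓ (R + 1)) ψ
  choose p hpΛ hp using hR
  -- With `p x` a point of `Λ` near `x`, the defect of `ψ ∘ p` is a value of `ψ` on `p x + (p y - p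
  -- (x + y))`, which runs through the finite set of points of `Λ + (Λ - Λ)` in `[-3R, 3R]`.
  obtain ⟨a, C, hC⟩ := exists_linear_approx_of_quasimorphism (f := ψ ∘ p) (C := C₁) (B := C₂)
    (by
      intro x y
      have e : ψ (p (x + y)) - ψ (p x) - ψ (p y) = - ψ (p x + (p y - p (x + y))) := by
        rw [map_add, map_sub]; ring
      simp only [Function.comp]
      rw [e, abs_neg]
      refine hC₁ _ ⟨⟨_, hpΛ x, _, ⟨_, hpΛ y, _, hpΛ (x + y), rfl⟩, rfl⟩, ?_⟩
      have h1 := abs_le.1 (hp x)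
      have h2 := abs_le.1 (hp y)
      have h3 := abs_le.1 (hp (x + y))
      exact ⟨by linarith [h1.1, h2.1, h3.2], by linarith [h1.2, h2.2, h3.1]⟩)
    (by
      intro x h0 h1
      refine hC₂ _ ⟨hself _ (hpΛ x), ?_⟩
      have h2 := abs_le.1 (hp x)
      exact ⟨by linarith [h2.1], by linarith [h2.2]⟩)
  refine ⟨a, C + 2 * C₁, fun x hx => ?_⟩
  have h1 := hC x
  simp only [Function.comp] at h1
  have h2 : |ψ (p 0 + (x - p x))| ≤ C₁ := by
    refine hC₁ _ ⟨⟨_, hpΛ 0, _, ⟨_, hx, _, hpΛ x, rfl⟩, rfl⟩, ?_⟩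
    have h1 := abs_le.1 (hp x)
    have h2 := abs_le.1 (hp 0)
    exact ⟨by linarith [h1.2, h2.1], by linarith [h1.1, h2.2]⟩
  have h3 : |ψ (p 0)| ≤ C₁ := hC₁ _ ⟨hself _ (hpΛ 0), by
    have h2 := abs_le.1 (hp 0)
    exact ⟨by linarith [h2.1], by linarith [h2.2]⟩⟩
  rw [map_add, map_sub] at h2
  rw [abs_le] at *
  constructor <;> linarith [h1.1, h1.2, h2.1, h2.2, h3.1, h3.2]

end Differences

/-! ### From dense differences to a lattice -/

section Differences

variable {Λ : Set ℝ} {c : ℝ}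

/-- If all differences of points of `Λ` are dense, a homomorphism which is bounded on `Λ` takes only
finitely many values on `Λ - Λ`: an extremal difference occurs only at the points of `Λ` at which
the homomorphism is almost minimal, and this set has many disjoint translates in `Λ + (Λ - Λ)`. -/
lemma HasDenseDifferences.finite_image (h : HasDenseDifferences Λ c) (hc : 0 < c)
    (hΛ : IsUniformlyDiscrete Λ) (σ : ℝ →+ ℝ) {B : ℝ} (hB : ∀ x ∈ Λ, |σ x| ≤ B) :
    (σ '' (Λ - Λ)).Finite := by
  obtain ⟨C, hC, hgrow⟩ := (h.translationBounded_add_sub hc hΛ).linear_growth one_pos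
  by_contra hinf
  obtain ⟨t, ht, htc⟩ := Set.Infinite.exists_subset_card_eq hinf (⌊C * 2 / c⌋₊ + 1)
  have ht' : ∀ v ∈ t, ∃ g, g ∈ Λ - Λ ∧ σ g = v := fun v hv => ht hv
  choose! g hgD hgσ using ht'
  have hne : Λ.Nonempty := by
    have : t.Nonempty := by rw [← Finset.card_pos]; omega
    obtain ⟨v, hv⟩ := this
    obtain ⟨x, hx, -⟩ := hgD v hv
    exact ⟨x, hx⟩
  have hbb : BddBelow (σ '' Λ) := ⟨-B, by rintro _ ⟨x, hx, rfl⟩; exact (abs_le.1 (hB x hx)).1⟩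
  have hba : BddAbove (σ '' Λ) := ⟨B, by rintro _ ⟨x, hx, rfl⟩; exact (abs_le.1 (hB x hx)).2⟩
  obtain ⟨η, hη, hη0⟩ : ∃ η : ℝ, (∀ p ∈ t.offDiag, 2 * η < |p.1 - p.2|) ∧ 0 < η := by
    have : ∀ᶠ η in 𝓝[>] (0 : ℝ), ∀ p ∈ t.offDiag, 2 * η < |p.1 - p.2| := by
      rw [eventually_all_finset]
      intro p hp
      have hp' : 0 < |p.1 - p.2| := abs_pos.2 (sub_ne_zero.2 (Finset.mem_offDiag.1 hp).2.2)
      have h0 : Tendsto (fun η : ℝ => 2 * η) (𝓝[>] 0) (𝓝 (2 * 0)) :=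
        (tendsto_id.const_mul 2).mono_left nhdsWithin_le_nhds
      exact h0.eventually (gt_mem_nhds (by simpa using hp'))
    exact (this.and self_mem_nhdsWithin).exists
  obtain ⟨_, ⟨x, hx, rfl⟩, hxm⟩ := exists_lt_of_csInf_lt (hne.image σ)
    (lt_add_of_pos_right (sInf (σ '' Λ)) hη0)
  obtain ⟨_, ⟨y, hy, rfl⟩, hyM⟩ := exists_lt_of_lt_csSup (hne.image σ)
    (sub_lt_self (sSup (σ '' Λ)) hη0)
  have hev : ∀ᶠ R : ℝ in atTop, ∀ v ∈ t, |g v| ≤ R := by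
    rw [eventually_all_finset]
    exact fun v _ => eventually_ge_atTop _
  obtain ⟨R, ⟨⟨s, hs, hsc⟩, hgR⟩, hR1⟩ :=
    (((h x hx y hy).and hev).and (eventually_ge_atTop 1)).exists
  -- The difference `y - x` raises `σ` by almost its full oscillation on `Λ`, so it can only start
  -- where `σ` is almost minimal.
  have hsσ : ∀ z ∈ s, sInf (σ '' Λ) ≤ σ z ∧ σ z ≤ sInf (σ '' Λ) + 2 * η := by
    intro z hz
    obtain ⟨h1, h2, -⟩ := hs z hz
    refine ⟨csInf_le hbb ⟨z, h1, rfl⟩, ?_⟩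
    have := le_csSup hba ⟨_, h2, rfl⟩
    rw [map_add, map_sub] at this
    linarith
  classical
  -- On the translate of `s` by `g v`, `σ` lies in an interval of length `2 * η` starting at `sInf
  -- (σ '' Λ) + v`. These intervals are disjoint by the choice of `η`, hence so are the translates.
  have hinj : Set.InjOn (fun p : ℝ × ℝ => p.2 + g p.1) (t ×ˢ s : Finset (ℝ × ℝ)) := by
    rintro ⟨u, z⟩ hp ⟨v, w⟩ hq hpq
    simp only [Finset.coe_product, Set.mem_prod, Finset.mem_coe] at hp hq hpq
    have huv : u = v := by
      by_contra huv
      have h1 := hη (u, v) (Finset.mem_offDiag.2 ⟨hp.1, hq.1, huv⟩)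
      have h2 := congrArg σ hpq
      rw [map_add, map_add, hgσ u hp.1, hgσ v hq.1] at h2
      have h3 := hsσ z hp.2
      have h4 := hsσ w hq.2
      rw [lt_abs] at h1
      rcases h1 with h1 | h1 <;> simp only at h1 <;> linarith [h3.1, h3.2, h4.1, h4.2]
    subst huv
    simpa using hpq
  have hcard := hgrow (2 * R) (by linarith) ((t ×ˢ s).image fun p : ℝ × ℝ => p.2 + g p.1) (by
    intro w hw
    obtain ⟨⟨v, z⟩, hp, rfl⟩ := Finset.mem_image.1 hw
    obtain ⟨hv, hz⟩ := Finset.mem_product.1 hp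
    refine ⟨⟨z, (hs z hz).1, g v, hgD v hv, rfl⟩, ?_⟩
    exact (abs_add_le _ _).trans (by linarith [(hs z hz).2.2, hgR v hv]))
  rw [Finset.card_image_of_injOn hinj, Finset.card_product, htc] at hcard
  push_cast at hcard
  have hfl := Nat.lt_floor_add_one (C * 2 / c)
  rw [div_lt_iff₀ hc] at hfl
  have hR0 : 0 < R := by linarith
  have : C * 2 * R < C * (2 * R) :=
    calc C * 2 * R < (⌊C * 2 / c⌋₊ + 1) * c * R := by gcongr
      _ = (⌊C * 2 / c⌋₊ + 1) * (c * R) := by ring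
      _ ≤ (⌊C * 2 / c⌋₊ + 1) * s.card := by gcongr
      _ ≤ C * (2 * R) := hcard
  linarith

/-- Relative density joins any two points of `Λ` by steps of length at most `2 * R + 1`. Adding the
fixed `x₀` to such a step gives a point of a bounded part of `Λ + (Λ - Λ)`, which is finite. -/
lemma IsRelativelyDense.span_fg {R ℓ : ℝ} (hR : IsRelativelyDense Λ R) (hℓ : 0 < ℓ)
    (h : TranslationBounded (Λ + (Λ - Λ)) ℓ) : (Submodule.span ℤ Λ).FG := by
  obtain ⟨x₀, hx₀, -⟩ := hR 0
  have hR0 : 0 ≤ R := (abs_nonneg _).trans (hR 0).choose_spec.2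
  set X : Set ℝ := insert x₀ ((Λ + (Λ - Λ)) ∩ Set.Icc (-(|x₀| + (2 * R + 1))) (|x₀| + (2 * R + 1)))
    with hX
  have hXfin : X.Finite := (h.finite_inter hℓ _).insert _
  have hx₀X : x₀ ∈ Submodule.span ℤ X := Submodule.subset_span (Set.mem_insert _ _)
  have hstep : ∀ x ∈ Λ, ∀ y ∈ Λ, |x - y| ≤ 2 * R + 1 → y ∈ Submodule.span ℤ X →
      x ∈ Submodule.span ℤ X := by
    intro x hx y hy hxy hyX
    have h1 : x₀ + (x - y) ∈ Submodule.span ℤ X := by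
      refine Submodule.subset_span (Or.inr ⟨⟨x₀, hx₀, _, ⟨x, hx, y, hy, rfl⟩, rfl⟩, ?_⟩)
      have := abs_le.1 ((abs_add_le x₀ (x - y)).trans (add_le_add_right hxy _))
      exact this
    have h2 : x = (x₀ + (x - y)) - x₀ + y := by ring
    rw [h2]
    exact add_mem (sub_mem h1 hx₀X) hyX
  have hall : ∀ n : ℕ, ∀ x ∈ Λ, |x - x₀| ≤ n + (2 * R + 1) → x ∈ Submodule.span ℤ X := by
    intro n
    induction n with
    | zero => exact fun x hx hxx => hstep x hx x₀ hx₀ (by simpa using hxx) hx₀X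
    | succ n ih =>
      intro x hx hxx
      by_cases hle : |x - x₀| ≤ 2 * R + 1
      · exact hstep x hx x₀ hx₀ hle hx₀X
      push Not at hle
      push_cast at hxx
      rcases le_total x₀ x with hxx₀ | hxx₀
      · rw [abs_of_nonneg (by linarith)] at hxx hle
        -- Aiming `R + 1` towards `x₀` guarantees progress of at least `1` and a step of at most `2
        -- * R + 1`.
        obtain ⟨y, hy, hyx⟩ := hR (x - (R + 1))
        rw [abs_le] at hyx
        refine hstep x hx y hy ?_ (ih y hy ?_)
        · rw [abs_le]; constructor <;> linarith [hyx.1, hyx.2]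
        · rw [abs_le]; constructor <;> linarith [hyx.1, hyx.2, (Nat.cast_nonneg n : (0 : ℝ) ≤ n)]
      · rw [abs_of_nonpos (by linarith)] at hxx hle
        obtain ⟨y, hy, hyx⟩ := hR (x + (R + 1))
        rw [abs_le] at hyx
        refine hstep x hx y hy ?_ (ih y hy ?_)
        · rw [abs_le]; constructor <;> linarith [hyx.1, hyx.2]
        · rw [abs_le]; constructor <;> linarith [hyx.1, hyx.2, (Nat.cast_nonneg n : (0 : ℝ) ≤ n)]
  have hspan : Submodule.span ℤ Λ = Submodule.span ℤ X := by
    apply le_antisymm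
    · rw [Submodule.span_le]
      intro x hx
      obtain ⟨n, hn⟩ := exists_nat_ge |x - x₀|
      exact hall n x hx (by linarith)
    · rw [Submodule.span_le]
      have hΛ : ∀ y ∈ Λ, y ∈ Submodule.span ℤ Λ := fun y hy => Submodule.subset_span hy
      rintro x (rfl | ⟨⟨a, ha, _, ⟨b, hb, d, hd, rfl⟩, rfl⟩, -⟩)
      · exact hΛ _ hx₀
      · exact add_mem (hΛ a ha) (sub_mem (hΛ b hb) (hΛ d hd))
  rw [hspan]
  exact Submodule.fg_span hXfin

lemma IsRelativelyDense.infinite {R : ℝ} (hR : IsRelativelyDense Λ R) : Λ.Infinite := by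
  intro hfin
  obtain ⟨B, hB⟩ := hfin.bddAbove
  obtain ⟨y, hy, hyx⟩ := hR (B + R + 1)
  have := hB hy
  rw [abs_le] at hyx
  linarith [hyx.1]

/-- A relatively dense uniformly discrete set, all of whose differences are dense, is contained in
finitely many translates of a lattice. -/
theorem HasDenseDifferences.exists_lattice {R : ℝ} (h : HasDenseDifferences Λ c) (hc : 0 < c)
    (hΛ : IsUniformlyDiscrete Λ) (hR : IsRelativelyDense Λ R) :
    ∃ α : ℝ, α ≠ 0 ∧ ∃ F : Set ℝ, F.Finite ∧ ∀ x ∈ Λ, ∃ k : ℤ, ∃ f ∈ F, x = k * α + f := by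
  have htb := h.translationBounded_add_sub hc hΛ
  have hfg := hR.span_fg one_pos htb
  have : Module.Finite ℤ (Submodule.span ℤ Λ) := Module.Finite.iff_fg.2 hfg
  let b := Module.Free.chooseBasis ℤ (Submodule.span ℤ Λ)
  -- Integer coordinates on the span extend to additive maps on `ℝ` because `ℝ` is divisible.
  have hext : ∀ i, ∃ ψ : ℝ →+ ℝ, ∀ g : Submodule.span ℤ Λ, ψ g = (b.repr g i : ℤ) := by
    intro i
    obtain ⟨ψ, hψ⟩ := Module.Baer.extension_property_addMonoidHom (Module.Baer.of_divisible ℝ)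
      (Submodule.span ℤ Λ).subtype.toAddMonoidHom Subtype.val_injective
      ((Int.castAddHom ℝ).comp (b.coord i).toAddMonoidHom)
    exact ⟨ψ, fun g => DFunLike.congr_fun hψ g⟩
  choose ψ hψ using hext
  choose a B hB using fun i => exists_linear_approx hR one_pos htb (ψ i)
  let σ : ∀ i, ℝ →+ ℝ := fun i => ψ i - AddMonoidHom.mulLeft (a i)
  have hσ : ∀ i x, σ i x = ψ i x - a i * x := fun i x => rfl
  have hfin : ∀ i, (σ i '' (Λ - Λ)).Finite := fun i => h.finite_image hc hΛ (σ i) (hB i)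
  let Φ : ℝ → (Module.Free.ChooseBasisIndex ℤ (Submodule.span ℤ Λ) → ℝ) := fun x i => σ i x
  have hΦ : (Φ '' (Λ - Λ)).Finite := by
    refine (Set.Finite.pi' hfin).subset ?_
    rintro _ ⟨x, hx, rfl⟩ i
    exact ⟨x, hx, rfl⟩
  -- `T` picks one difference for each of the finitely many value vectors `Φ`; differences with
  -- equal vectors agree modulo the subgroup `K` below.
  obtain ⟨T, hTsub, hTfin, hTimg⟩ : ∃ T ⊆ Λ - Λ, T.Finite ∧ Φ '' T = Φ '' (Λ - Λ) := by
    obtain ⟨T, hT, hT2⟩ := Set.SurjOn.exists_bijOn_subset (Set.surjOn_image Φ (Λ - Λ))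
    refine ⟨T, hT, ?_, hT2.image_eq⟩
    exact Set.Finite.of_injOn hT2.mapsTo hT2.injOn hΦ
  let K : AddSubgroup ℝ :=
    (Submodule.span ℤ Λ).toAddSubgroup ⊓ ⨅ i, (σ i).ker
  have hK : ∀ x, x ∈ K ↔ x ∈ Submodule.span ℤ Λ ∧ ∀ i, σ i x = 0 := by
    intro x
    simp [K, AddSubgroup.mem_inf, AddSubgroup.mem_iInf, AddMonoidHom.mem_ker]
  obtain ⟨ε, hε, hεa⟩ : ∃ ε : ℝ, 0 < ε ∧ ∀ i, |a i| * ε < 1 := by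
    refine ⟨1 / (1 + ∑ i, |a i|), by positivity, fun i => ?_⟩
    have : |a i| ≤ ∑ i, |a i| := Finset.single_le_sum (f := fun i => |a i|)
      (fun j _ => abs_nonneg _) (Finset.mem_univ i)
    rw [mul_one_div, div_lt_one (by positivity)]
    linarith
  -- On `K` the integer coordinates of `x` equal `a i * x`. For `0 < x < ε` they are smaller than
  -- `1` in modulus, hence zero.
  have hiso : Disjoint (K : Set ℝ) (Set.Ioo 0 ε) := by
    rw [Set.disjoint_left]
    intro x hx hx2
    obtain ⟨hxs, hxσ⟩ := (hK x).1 hx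
    have h0 : (⟨x, hxs⟩ : Submodule.span ℤ Λ) = 0 := by
      apply b.repr.injective
      rw [map_zero]
      ext i
      have h1 := hψ i ⟨x, hxs⟩
      have h2 := hxσ i
      rw [hσ] at h2
      have h3 : ((b.repr ⟨x, hxs⟩ i : ℤ) : ℝ) = a i * x := by rw [← h1]; simp only; linarith
      have h4 : |((b.repr ⟨x, hxs⟩ i : ℤ) : ℝ)| < 1 := by
        rw [h3, abs_mul, abs_of_pos hx2.1]
        exact (mul_le_mul_of_nonneg_left hx2.2.le (abs_nonneg _)).trans_lt (hεa i)
      rw [Finsupp.zero_apply]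
      exact Int.abs_lt_one_iff.1 (by exact_mod_cast h4)
    have : x = 0 := congrArg Subtype.val h0
    exact hx2.1.ne' this
  obtain ⟨α, hα⟩ := AddSubgroup.cyclic_of_isolated_zero hε hiso
  obtain ⟨x₀, hx₀, -⟩ := hR 0
  have hΛspan : ∀ x ∈ Λ, x ∈ Submodule.span ℤ Λ := fun x hx => Submodule.subset_span hx
  have hDspan : ∀ x ∈ Λ - Λ, x ∈ Submodule.span ℤ Λ := by
    rintro _ ⟨x, hx, y, hy, rfl⟩
    exact sub_mem (hΛspan x hx) (hΛspan y hy)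
  have hcov : ∀ x ∈ Λ, ∃ k : ℤ, ∃ f ∈ (fun t => t + x₀) '' T, x = k * α + f := by
    intro x hx
    have hxD : x - x₀ ∈ Λ - Λ := ⟨x, hx, x₀, hx₀, rfl⟩
    obtain ⟨t, htT, htΦ⟩ : Φ (x - x₀) ∈ Φ '' T := hTimg ▸ ⟨_, hxD, rfl⟩
    have hmem : x - x₀ - t ∈ K := by
      rw [hK]
      refine ⟨sub_mem (hDspan _ hxD) (hDspan _ (hTsub htT)), fun i => ?_⟩
      have := congrFun htΦ i
      simp only [Φ] at this
      rw [map_sub, this, sub_self]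
    rw [hα, AddSubgroup.mem_closure_singleton] at hmem
    obtain ⟨k, hk⟩ := hmem
    refine ⟨k, t + x₀, ⟨t, htT, rfl⟩, ?_⟩
    rw [zsmul_eq_mul] at hk
    rw [hk]; ring
  refine ⟨α, ?_, _, hTfin.image _, hcov⟩
  rintro rfl
  refine hR.infinite ((hTfin.image fun t => t + x₀).subset fun x hx => ?_)
  obtain ⟨k, f, hf, rfl⟩ := hcov x hx
  simpa using hf

end Differences

/-! ### Spectral gaps force positive density -/

/-- The character `x ↦ exp (2 π i x)` of the real line. -/
noncomputable def cexpTwoPi (x : ℝ) : ℂ := Complex.exp (2 * Real.pi * x * Complex.I)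

lemma cexpTwoPi_add (x y : ℝ) : cexpTwoPi (x + y) = cexpTwoPi x * cexpTwoPi y := by
  rw [cexpTwoPi, cexpTwoPi, cexpTwoPi, ← Complex.exp_add]
  congr 1
  push_cast
  ring

@[simp] lemma cexpTwoPi_zero : cexpTwoPi 0 = 1 := by simp [cexpTwoPi]

@[simp] lemma norm_cexpTwoPi (x : ℝ) : ‖cexpTwoPi x‖ = 1 := by
  rw [cexpTwoPi, ← Complex.norm_exp_ofReal_mul_I (2 * Real.pi * x)]
  push_cast
  rfl

lemma cexpTwoPi_ne_zero (x : ℝ) : cexpTwoPi x ≠ 0 := Complex.exp_ne_zero _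

lemma cexpTwoPi_nat_mul (n : ℕ) (x : ℝ) : cexpTwoPi (n * x) = cexpTwoPi x ^ n := by
  rw [cexpTwoPi, cexpTwoPi, ← Complex.exp_nat_mul]
  congr 1
  push_cast
  ring

lemma cexpTwoPi_int (k : ℤ) : cexpTwoPi k = 1 := by
  rw [cexpTwoPi, Complex.exp_eq_one_iff]
  exact ⟨k, by push_cast; ring⟩

lemma four_mul_abs_le_norm_one_sub_cexpTwoPi {u : ℝ} (hu : |u| ≤ 1 / 2) :
    4 * |u| ≤ ‖1 - cexpTwoPi u‖ := by
  have h1 : ‖1 - cexpTwoPi u‖ = 2 * |Real.sin (Real.pi * u)| := by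
    rw [norm_sub_rev, cexpTwoPi]
    have e : (2 * Real.pi * u * Complex.I : ℂ) = Complex.I * ((2 * Real.pi * u : ℝ) : ℂ) := by
      push_cast; ring
    rw [e, Complex.norm_exp_I_mul_ofReal_sub_one, Real.norm_eq_abs, abs_mul, abs_two]
    congr 3
    ring
  rw [h1]
  have hpi := Real.pi_pos
  have h2 : 2 / Real.pi * (Real.pi * |u|) ≤ Real.sin (Real.pi * |u|) :=
    Real.mul_le_sin (by positivity) (by nlinarith)
  have h3 : |Real.sin (Real.pi * u)| = |Real.sin (Real.pi * |u|)| := by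
    rcases abs_cases u with ⟨h, -⟩ | ⟨h, -⟩ <;> rw [h]
    rw [mul_neg, Real.sin_neg, abs_neg]
  have h4 : 2 / Real.pi * (Real.pi * |u|) = 2 * |u| := by field_simp
  rw [h4] at h2
  rw [h3]
  linarith [le_abs_self (Real.sin (Real.pi * |u|))]

section Vanishing

variable {ι : Type*} {x : ι → ℝ} {W : ι → ℂ} {τ : ℝ}

/-- The Fourier transform of the finite measure `∑ i, W i δ_(x i)` vanishes on `[-τ, τ]`. -/
def SpectrumVanishes (x : ι → ℝ) (W : ι → ℂ) (τ : ℝ) : Prop :=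
  ∀ t, |t| ≤ τ → ∑' i, W i * cexpTwoPi (t * x i) = 0

lemma Summable.mul_of_norm_le {W g : ι → ℂ} {C : ℝ} (hW : Summable fun i => ‖W i‖)
    (hg : ∀ i, ‖g i‖ ≤ C) : Summable fun i => ‖W i * g i‖ := by
  refine Summable.of_nonneg_of_le (fun _ => norm_nonneg _) (fun i => ?_) (hW.mul_right C)
  rw [norm_mul]
  gcongr
  exact hg i

/-- On the transform this multiplier subtracts a unimodular multiple of the translate by `β`, so the
gap shrinks by `β`. It kills the mass at any point equal to `y`. -/
lemma SpectrumVanishes.mul_one_sub (h : SpectrumVanishes x W τ) (hW : Summable fun i => ‖W i‖)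
    {β : ℝ} (hβ : 0 ≤ β) (y : ℝ) :
    SpectrumVanishes x (fun i => W i * (1 - cexpTwoPi (β * (x i - y)))) (τ - β) := by
  intro t ht
  have hs : ∀ t, Summable fun i => W i * cexpTwoPi (t * x i) := fun t =>
    (hW.mul_of_norm_le (C := 1) fun i => (norm_cexpTwoPi _).le).of_norm
  have e : ∀ i, W i * (1 - cexpTwoPi (β * (x i - y))) * cexpTwoPi (t * x i)
      = W i * cexpTwoPi (t * x i) - cexpTwoPi (-β * y) * (W i * cexpTwoPi ((t + β) * x i)) := by
    intro i
    have h1 : β * (x i - y) = -β * y + β * x i := by ring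
    rw [h1, add_mul, cexpTwoPi_add, cexpTwoPi_add]
    ring
  simp_rw [e]
  rw [(hs t).tsum_sub ((hs _).mul_left _), tsum_mul_left, h t (by linarith), h (t + β), mul_zero,
    sub_zero]
  exact (abs_add_le _ _).trans (by rw [abs_of_nonneg hβ]; linarith)

lemma integral_exp_mul_eq_sinc (r : ℝ) :
    ∫ u in (-1 : ℝ)..1, Complex.exp (r * u * Complex.I) = 2 * Real.sinc r := by
  rcases eq_or_ne r 0 with rfl | hr
  · simp; norm_num
  have h := intervalIntegral.integral_comp_mul_left (a := -1) (b := 1)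
    (fun t : ℝ => Complex.exp (t * Complex.I)) hr
  simp only [mul_neg, mul_one, Complex.ofReal_mul] at h
  rw [h, integral_exp_mul_I_eq_sinc, Real.sinc_of_ne_zero hr]
  have hr' : (r : ℂ) ≠ 0 := Complex.ofReal_ne_zero.2 hr
  rw [Complex.real_smul]
  push_cast
  field_simp

/-- The multiplier is an average of characters of frequency at most `γ / 2`, so the gap shrinks only
by `γ / 2`, while the factor is `1` at `y` and small far from it. -/
lemma SpectrumVanishes.mul_sinc [Countable ι] (h : SpectrumVanishes x W τ)
    (hW : Summable fun i => ‖W i‖) {γ : ℝ} (hγ : 0 ≤ γ) (y : ℝ) :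
    SpectrumVanishes x (fun i => W i * Real.sinc (Real.pi * γ * (x i - y))) (τ - γ / 2) := by
  intro t ht
  have hsum := intervalIntegral.hasSum_integral_of_dominated_convergence (a := -1) (b := 1)
    (μ := MeasureTheory.volume)
    (F := fun i (u : ℝ) => W i * cexpTwoPi (t * x i) *
      Complex.exp (((Real.pi * γ * (x i - y) : ℝ) : ℂ) * u * Complex.I))
    (f := fun _ => 0) (fun i _ => ‖W i‖) ?_ ?_ ?_ ?_ ?_
  · have e : ∀ i, ∫ u in (-1 : ℝ)..1, W i * cexpTwoPi (t * x i) *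
        Complex.exp (((Real.pi * γ * (x i - y) : ℝ) : ℂ) * u * Complex.I)
        = 2 * (W i * Real.sinc (Real.pi * γ * (x i - y)) * cexpTwoPi (t * x i)) := by
      intro i
      rw [intervalIntegral.integral_const_mul, integral_exp_mul_eq_sinc]
      ring
    simp_rw [e] at hsum
    rw [intervalIntegral.integral_zero] at hsum
    have := hsum.tsum_eq
    rw [tsum_mul_left] at this
    simpa using this
  · intro i
    exact Continuous.aestronglyMeasurable (by fun_prop)
  · intro i
    refine Eventually.of_forall fun u _ => ?_
    rw [norm_mul, norm_mul, norm_cexpTwoPi, ← Complex.ofReal_mul, Complex.norm_exp_ofReal_mul_I]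
    simp
  · exact Eventually.of_forall fun u _ => hW
  · exact intervalIntegrable_const
  · refine Eventually.of_forall fun u hu => ?_
    rw [Set.uIoc_of_le (by norm_num)] at hu
    have hs : Summable fun i => W i * cexpTwoPi ((t + γ * u / 2) * x i) :=
      (hW.mul_of_norm_le (C := 1) fun i => (norm_cexpTwoPi _).le).of_norm
    have e : ∀ i, W i * cexpTwoPi (t * x i) *
        Complex.exp (((Real.pi * γ * (x i - y) : ℝ) : ℂ) * u * Complex.I)
        = cexpTwoPi (-(γ * u / 2 * y)) * (W i * cexpTwoPi ((t + γ * u / 2) * x i)) := by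
      intro i
      have h1 : Complex.exp (((Real.pi * γ * (x i - y) : ℝ) : ℂ) * u * Complex.I)
          = cexpTwoPi (-(γ * u / 2 * y) + γ * u / 2 * x i) := by
        rw [cexpTwoPi]
        congr 1
        push_cast
        ring
      rw [h1, cexpTwoPi_add, add_mul, cexpTwoPi_add]
      ring
    simp_rw [e]
    have h0 := h (t + γ * u / 2) (by
      refine (abs_add_le _ _).trans ?_
      have : |γ * u / 2| ≤ γ / 2 := by
        rw [abs_le]
        constructor <;> nlinarith [hu.1, hu.2]
      linarith)
    have := hs.hasSum.mul_left (cexpTwoPi (-(γ * u / 2 * y)))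
    rwa [h0, mul_zero] at this

lemma SpectrumVanishes.mul_prod (h : SpectrumVanishes x W τ) (hW : Summable fun i => ‖W i‖)
    {β : ℝ} (hβ : 0 ≤ β) (s : Finset ι) :
    SpectrumVanishes x (fun i => W i * ∏ j ∈ s, (1 - cexpTwoPi (β * (x i - x j))))
      (τ - s.card * β) := by
  classical
  induction s using Finset.induction_on with
  | empty => simpa using h
  | insert j s hj ih =>
    have hb : ∀ i, ‖∏ j ∈ s, (1 - cexpTwoPi (β * (x i - x j)))‖ ≤ 2 ^ s.card := fun i => by
      rw [norm_prod]
      rw [← Finset.prod_const]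
      refine Finset.prod_le_prod (fun _ _ => norm_nonneg _) fun k _ => ?_
      exact (norm_sub_le _ _).trans (by simp; norm_num)
    have := ih.mul_one_sub (hW.mul_of_norm_le hb) hβ (x j)
    rw [Finset.card_insert_of_notMem hj]
    have e : τ - ((s.card + 1 : ℕ) : ℝ) * β = τ - s.card * β - β := by push_cast; ring
    rw [e]
    convert this using 2 with i
    rw [Finset.prod_insert hj]
    ring

lemma SpectrumVanishes.mul_sinc_pow [Countable ι] (h : SpectrumVanishes x W τ)
    (hW : Summable fun i => ‖W i‖) {γ : ℝ} (hγ : 0 ≤ γ) (y : ℝ) (m : ℕ) :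
    SpectrumVanishes x (fun i => W i * (Real.sinc (Real.pi * γ * (x i - y)) : ℂ) ^ m)
      (τ - m * (γ / 2)) := by
  induction m with
  | zero => simpa using h
  | succ m ih =>
    have hb : ∀ i, ‖(Real.sinc (Real.pi * γ * (x i - y)) : ℂ) ^ m‖ ≤ 1 := fun i => by
      rw [norm_pow, Complex.norm_real, Real.norm_eq_abs]
      exact pow_le_one₀ (abs_nonneg _) (Real.abs_sinc_le_one _)
    have := ih.mul_sinc (hW.mul_of_norm_le hb) hγ y
    have e : τ - ((m + 1 : ℕ) : ℝ) * (γ / 2) = τ - m * (γ / 2) - γ / 2 := by push_cast; ring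
    rw [e]
    convert this using 2 with i
    rw [pow_succ]
    ring

/-- The product of the distances of `n` separated points to a further point is at least of the size
of `(d / 2) ^ n * n !`. -/
lemma pow_mul_factorial_le_prod {d y : ℝ} (hd : 0 < d) (s : Finset ι)
    (hsep : ∀ i ∈ s, ∀ j ∈ s, i ≠ j → d ≤ |x i - x j|) (hy : ∀ i ∈ s, d ≤ |x i - y|) :
    (d / 2) ^ s.card * (s.card.factorial : ℝ) ≤ ∏ i ∈ s, |x i - y| := by
  classical
  induction hn : s.card generalizing s with
  -- For the inductive step, remove the point `a` farthest from `y`. The remaining points, `a` and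
  -- `y` itself are `d`-separated in an interval of length `2 * |x a - y|`, so `|x a - y| ≥ (n + 1)
  -- * d / 2`.
  | zero => rw [Finset.card_eq_zero] at hn; simp [hn]
  | succ n ih =>
    obtain ⟨a, ha, hmax⟩ := s.exists_max_image (fun i => |x i - y|)
      (Finset.card_pos.1 (by omega))
    have hinj : Set.InjOn x s := by
      intro i hi j hj hij
      by_contra hne
      have := hsep i hi j hj hne
      rw [hij, sub_self, abs_zero] at this
      linarith
    have hynot : y ∉ s.image x := by
      rintro hmem
      obtain ⟨i, hi, hxi⟩ := Finset.mem_image.1 hmem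
      have := hy i hi
      rw [hxi, sub_self, abs_zero] at this
      linarith
    have hcount := card_mul_le_of_separated (x := y - |x a - y|) (L := 2 * |x a - y|) hd
      (by positivity) (s := insert y (s.image x))
      (by
        intro z hz
        have : |z - y| ≤ |x a - y| := by
          rcases Finset.mem_insert.1 hz with rfl | hz
          · simp
          · obtain ⟨i, hi, rfl⟩ := Finset.mem_image.1 hz
            exact hmax i hi
        rw [abs_le] at this
        exact ⟨by linarith [this.1], by linarith [this.2]⟩)
      (by
        intro z hz w hw hzw
        rcases Finset.mem_insert.1 hz with hz' | hz' <;>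
          rcases Finset.mem_insert.1 hw with hw' | hw'
        · exact absurd (hz'.trans hw'.symm) hzw
        · obtain ⟨i, hi, rfl⟩ := Finset.mem_image.1 hw'
          rw [abs_sub_comm, hz']; exact hy i hi
        · obtain ⟨i, hi, rfl⟩ := Finset.mem_image.1 hz'
          rw [hw']; exact hy i hi
        · obtain ⟨i, hi, rfl⟩ := Finset.mem_image.1 hz'
          obtain ⟨j, hj, rfl⟩ := Finset.mem_image.1 hw'
          exact hsep i hi j hj fun h => hzw (by rw [h]))
    rw [Finset.card_insert_of_notMem hynot, Finset.card_image_of_injOn hinj, hn] at hcount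
    push_cast at hcount
    have h1 := ih (s.erase a) (fun i hi j hj => hsep i (Finset.mem_of_mem_erase hi) j
      (Finset.mem_of_mem_erase hj)) (fun i hi => hy i (Finset.mem_of_mem_erase hi))
      (by rw [Finset.card_erase_of_mem ha, hn]; rfl)
    rw [← Finset.mul_prod_erase s _ ha]
    calc (d / 2) ^ (n + 1) * ((n + 1).factorial : ℝ)
        = ((n + 1) * (d / 2)) * ((d / 2) ^ n * (n.factorial : ℝ)) := by
          rw [Nat.factorial_succ]; push_cast; ring
      _ ≤ |x a - y| * ∏ i ∈ s.erase a, |x i - y| := by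
          refine mul_le_mul (by linarith) h1 (by positivity) (abs_nonneg _)

/-- A uniformly discrete set supporting a nonzero finite measure whose Fourier transform vanishes on
`[-τ, τ]` has positive lower density, bounded below in terms of `τ` and the separation `d`. -/
theorem exists_density_of_spectrumVanishes {d τ : ℝ} (hd : 0 < d) (hτ : 0 < τ) :
    ∃ c > 0, ∀ (Λ : Set ℝ), Λ.Countable → (∀ x ∈ Λ, ∀ y ∈ Λ, x ≠ y → d ≤ |x - y|) →
      (∀ y R, (Λ ∩ Set.Icc (y - R) (y + R)).Finite) → ∀ W : Λ → ℂ,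
      (Summable fun i => ‖W i‖) → SpectrumVanishes (Subtype.val : Λ → ℝ) W τ →
      ∀ i₀, W i₀ ≠ 0 → ∀ᶠ R : ℝ in atTop, ∃ s : Finset ℝ,
        (∀ z ∈ s, z ∈ Λ ∧ |z - i₀| ≤ R) ∧ c * R ≤ s.card := by
  obtain ⟨p, hp0, hp⟩ : ∃ p : ℝ, 0 ≤ p ∧ 2 * Real.exp (-p) / d ≤ τ / 8 := by
    have h1 : Tendsto (fun p : ℝ => 2 * Real.exp (-p) / d) atTop (𝓝 (2 * 0 / d)) :=
      (Real.tendsto_exp_neg_atTop_nhds_zero.const_mul 2).div_const d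
    rw [mul_zero, zero_div] at h1
    obtain ⟨p, h2, h3⟩ := ((h1.eventually (ge_mem_nhds (by positivity : 0 < τ / 8))).and
      (eventually_ge_atTop 0)).exists
    exact ⟨p, h3, h2⟩
  -- The factor `p + 1` will give `p * n ≤ τ / 8 * R` for the number `n` of other points within `R`;
  -- with the bound on `exp (-p)`, this makes the loss from isolating `i₀` at most `exp (τ / 4 *
  -- R)`.
  refine ⟨τ / (8 * (p + 1)), by positivity, fun Λ hcount hsep hfin W hW hvan i₀ hi₀ => ?_⟩
  have : Countable Λ := hcount.to_subtype
  set M := ∑' i, ‖W i‖ with hM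
  have hlim : Tendsto (fun R : ℝ => Real.exp (1 - τ / 4 * R) * M) atTop (𝓝 (0 * M)) := by
    refine Tendsto.mul_const _ (Real.tendsto_exp_atBot.comp ?_)
    exact tendsto_atBot_add_const_left _ _
      (tendsto_neg_atTop_atBot.comp (tendsto_id.const_mul_atTop (by positivity)))
  rw [zero_mul] at hlim
  filter_upwards [hlim.eventually (gt_mem_nhds (norm_pos_iff.2 hi₀)), eventually_ge_atTop 1]
    with R hR hR1
  have hR0 : 0 < R := by linarith
  classical
  have hfin' : {i : Λ | |(i : ℝ) - i₀| ≤ R}.Finite := by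
    refine Set.Finite.of_finite_image ((hfin i₀ R).subset ?_) Subtype.val_injective.injOn
    rintro _ ⟨i, hi, rfl⟩
    have := abs_le.1 (show |(i : ℝ) - i₀| ≤ R from hi)
    exact ⟨i.2, by linarith [this.1], by linarith [this.2]⟩
  set s := hfin'.toFinset with hs
  have hmem : ∀ i, i ∈ s ↔ |(i : ℝ) - i₀| ≤ R := fun i => by simp [hs]
  refine ⟨s.map (Function.Embedding.subtype _), ?_, ?_⟩
  · intro z hz
    obtain ⟨i, hi, rfl⟩ := Finset.mem_map.1 hz
    exact ⟨i.2, (hmem i).1 hi⟩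
  rw [Finset.card_map]
  by_contra! hlt
  set s' := s.erase i₀ with hs'
  set n := s'.card with hn
  have hnlt : (n : ℝ) < τ / (8 * (p + 1)) * R :=
    lt_of_le_of_lt (by exact_mod_cast Finset.card_erase_le) hlt
  have hpn : (p + 1) * n ≤ τ / 8 * R := by
    have : τ / (8 * (p + 1)) * R = τ / 8 * R / (p + 1) := by field_simp
    rw [this, lt_div_iff₀ (by positivity)] at hnlt
    linarith
  -- The power `m` gains `exp (-m)`, about `exp (-τ / 2 * R)`, outside radius `R`, at a cost of at
  -- most `τ / 4` of the gap.
  set m := ⌊τ / 2 * R⌋₊ with hm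
  have hmle : (m : ℝ) ≤ τ / 2 * R := Nat.floor_le (by positivity)
  have hmgt : τ / 2 * R < m + 1 := Nat.lt_floor_add_one _
  -- `Q` vanishes at every other point within `R` of `i₀`. The step `1 / (2 * R)` keeps the
  -- arguments at `i₀` in `[-1/2, 1/2]`, where `4 * |u| ≤ ‖1 - cexpTwoPi u‖`.
  set Q : Λ → ℂ := fun i => ∏ j ∈ s', (1 - cexpTwoPi (1 / (2 * R) * ((i : ℝ) - j))) with hQ
  have hQb : ∀ i, ‖Q i‖ ≤ 2 ^ n := fun i => by
    rw [hQ, norm_prod, hn, ← Finset.prod_const]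
    refine Finset.prod_le_prod (fun _ _ => norm_nonneg _) fun k _ => ?_
    exact (norm_sub_le _ _).trans (by simp; norm_num)
  have hWQ := hW.mul_of_norm_le hQb
  set S : Λ → ℂ := fun i => (Real.sinc (Real.pi * (1 / R) * ((i : ℝ) - i₀)) : ℂ) ^ m with hS
  have hvan' := ((hvan.mul_prod hW (β := 1 / (2 * R)) (by positivity) s').mul_sinc_pow hWQ
    (γ := 1 / R) (by positivity) i₀ m) 0 (by
      rw [abs_zero]
      have h1 : (s'.card : ℝ) * (1 / (2 * R)) ≤ τ / 16 := by
        rw [mul_one_div, div_le_iff₀ (by positivity)]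
        have : (0 : ℝ) ≤ p * n := by positivity
        rw [← hn]
        linarith
      have h2 : (m : ℝ) * (1 / R / 2) ≤ τ / 4 := by
        have : (m : ℝ) * (1 / R / 2) = m / (2 * R) := by field_simp
        rw [this, div_le_iff₀ (by positivity)]
        linarith
      linarith)
  simp only [zero_mul, cexpTwoPi_zero, mul_one] at hvan'
  change ∑' i, W i * Q i * S i = 0 at hvan'
  have hSb : ∀ i, ‖S i‖ ≤ 1 := fun i => by
    rw [hS, norm_pow, Complex.norm_real, Real.norm_eq_abs]
    exact pow_le_one₀ (abs_nonneg _) (Real.abs_sinc_le_one _)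
  have hWQS := hWQ.mul_of_norm_le hSb
  rw [hWQS.of_norm.tsum_eq_add_tsum_ite i₀] at hvan'
  have hS0 : S i₀ = 1 := by simp [hS]
  have hterm : ∀ i, ‖(if i = i₀ then 0 else W i * Q i * S i)‖ ≤
      ‖W i‖ * (2 ^ n * Real.exp (-m)) := by
    intro i
    split_ifs with h
    · rw [norm_zero]; positivity
    by_cases hi : i ∈ s
    · have : Q i = 0 := Finset.prod_eq_zero (Finset.mem_erase.2 ⟨h, hi⟩) (by simp)
      rw [this, mul_zero, zero_mul, norm_zero]
      positivity
    · rw [hmem, not_le] at hi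
      rw [norm_mul, norm_mul, mul_assoc]
      gcongr
      · exact hQb i
      · rw [hS, norm_pow, Complex.norm_real, Real.norm_eq_abs, ← mul_one (-(m : ℝ)), neg_mul,
          ← mul_neg, Real.exp_nat_mul]
        gcongr
        have hne : Real.pi * (1 / R) * ((i : ℝ) - i₀) ≠ 0 := by
          have : (i : ℝ) - i₀ ≠ 0 := abs_pos.1 (hR0.trans hi)
          have := Real.pi_pos
          positivity
        rw [Real.sinc_of_ne_zero hne, abs_div, Real.exp_neg, ← one_div]
        have h1 : Real.exp 1 ≤ |Real.pi * (1 / R) * ((i : ℝ) - i₀)| := by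
          rw [abs_mul, abs_of_pos (by positivity)]
          calc Real.exp 1 ≤ Real.pi := by linarith [Real.exp_one_lt_d9, Real.pi_gt_three]
            _ = Real.pi * (1 / R) * R := by field_simp
            _ ≤ _ := by gcongr
        exact div_le_div₀ zero_le_one (Real.abs_sin_le_one _) (Real.exp_pos _) h1
  have hmain : ‖W i₀‖ * ‖Q i₀‖ ≤ M * (2 ^ n * Real.exp (-m)) := by
    rw [hS0, mul_one, ← eq_neg_iff_add_eq_zero] at hvan'
    rw [← norm_mul, hvan', norm_neg]
    exact tsum_of_norm_bounded (hW.hasSum.mul_right _) hterm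
  -- The factor `2 ^ n` here cancels the one in the upper bound for `Q` far from `i₀`.
  have hQ0 : 2 ^ n * (((d / 2) ^ n * (n.factorial : ℝ)) / R ^ n) ≤ ‖Q i₀‖ := by
    have h1 := pow_mul_factorial_le_prod (x := (Subtype.val : Λ → ℝ)) (y := i₀) hd s'
      (fun i _ j _ hij => hsep i i.2 j j.2 (Subtype.val_injective.ne hij))
      (fun i hi => hsep i i.2 i₀ i₀.2 (Subtype.val_injective.ne (Finset.mem_erase.1 hi).1))
    calc 2 ^ n * (((d / 2) ^ n * (n.factorial : ℝ)) / R ^ n)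
        ≤ 2 ^ n * ((∏ i ∈ s', |(i : ℝ) - i₀|) / R ^ n) := by gcongr
      _ = ∏ i ∈ s', 2 * (|(i : ℝ) - i₀| / R) := by
          rw [Finset.prod_mul_distrib, Finset.prod_div_distrib, Finset.prod_const,
            Finset.prod_const]
      _ ≤ ‖Q i₀‖ := by
          rw [hQ, norm_prod]
          refine Finset.prod_le_prod (fun _ _ => by positivity) fun j hj => ?_
          have hj' := (hmem j).1 (Finset.mem_of_mem_erase hj)
          have e : |1 / (2 * R) * ((i₀ : ℝ) - j)| = |(j : ℝ) - i₀| / (2 * R) := by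
            rw [abs_mul, abs_of_pos (by positivity), abs_sub_comm]
            ring
          refine le_trans (le_of_eq ?_) (four_mul_abs_le_norm_one_sub_cexpTwoPi ?_)
          · rw [e]; ring
          · rw [e, div_le_iff₀ (by positivity)]; linarith
  have hfac : R ^ n ≤ (d / 2) ^ n * (n.factorial : ℝ) * Real.exp (τ / 4 * R) := by
    have h1 := Real.pow_div_factorial_le_exp (2 * Real.exp (-p) / d * R) (by positivity) n
    rw [div_le_iff₀ (by positivity)] at h1
    have h2 : Real.exp (2 * Real.exp (-p) / d * R) ≤ Real.exp (τ / 8 * R) := by gcongr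
    have h3 : Real.exp (p * n) ≤ Real.exp (τ / 8 * R) := by
      apply Real.exp_le_exp.2
      have : (0 : ℝ) ≤ n := by positivity
      linarith
    have h4 : R ^ n = (d / 2) ^ n * (2 * Real.exp (-p) / d * R) ^ n * Real.exp (p * n) := by
      have : Real.exp (p * n) = Real.exp p ^ n := by rw [mul_comm, Real.exp_nat_mul]
      rw [this, ← mul_pow, ← mul_pow]
      congr 1
      rw [Real.exp_neg]
      field_simp
    rw [h4]
    calc (d / 2) ^ n * (2 * Real.exp (-p) / d * R) ^ n * Real.exp (p * n)
        ≤ (d / 2) ^ n * (Real.exp (τ / 8 * R) * n.factorial) * Real.exp (τ / 8 * R) := by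
          gcongr
          exact h1.trans (by gcongr)
      _ = (d / 2) ^ n * (n.factorial : ℝ) * (Real.exp (τ / 8 * R) * Real.exp (τ / 8 * R)) := by
          ring
      _ = _ := by rw [← Real.exp_add]; congr 2; ring
  have hM0 : 0 ≤ M := tsum_nonneg fun _ => norm_nonneg _
  have hfinal : ‖W i₀‖ ≤ Real.exp (1 - τ / 4 * R) * M := by
    have hq : 0 < (d / 2) ^ n * (n.factorial : ℝ) / R ^ n := by positivity
    have h1 : ‖W i₀‖ * ((d / 2) ^ n * (n.factorial : ℝ) / R ^ n) ≤ M * Real.exp (-m) := by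
      have h2 : (0 : ℝ) < 2 ^ n := by positivity
      refine le_of_mul_le_mul_left ?_ h2
      calc 2 ^ n * (‖W i₀‖ * ((d / 2) ^ n * (n.factorial : ℝ) / R ^ n))
          = ‖W i₀‖ * (2 ^ n * ((d / 2) ^ n * (n.factorial : ℝ) / R ^ n)) := by ring
        _ ≤ ‖W i₀‖ * ‖Q i₀‖ := by gcongr
        _ ≤ _ := hmain
        _ = _ := by ring
    have h2 : 1 ≤ (d / 2) ^ n * (n.factorial : ℝ) / R ^ n * Real.exp (τ / 4 * R) := by
      rw [div_mul_eq_mul_div, le_div_iff₀ (by positivity), one_mul]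
      exact hfac
    calc ‖W i₀‖ ≤ ‖W i₀‖ * ((d / 2) ^ n * (n.factorial : ℝ) / R ^ n * Real.exp (τ / 4 * R)) :=
          le_mul_of_one_le_right (norm_nonneg _) h2
      _ = ‖W i₀‖ * ((d / 2) ^ n * (n.factorial : ℝ) / R ^ n) * Real.exp (τ / 4 * R) := by ring
      _ ≤ M * Real.exp (-m) * Real.exp (τ / 4 * R) := by gcongr
      _ = M * Real.exp (-m + τ / 4 * R) := by rw [mul_assoc, ← Real.exp_add]
      _ ≤ M * Real.exp (1 - τ / 4 * R) := by gcongr; linarith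
      _ = _ := mul_comm _ _
  linarith

end Vanishing

/-! ### Test functions and seminorm estimates -/

/-- A smooth function supported in `(-ε, ε)` which equals one on `[-ε / 2, ε / 2]`. -/
lemma exists_smooth_cutoff {ε : ℝ} (hε : 0 < ε) : ∃ ρ : ℝ → ℝ, ContDiff ℝ ∞ ρ ∧
    HasCompactSupport ρ ∧ (∀ x, |x| ≤ ε / 2 → ρ x = 1) ∧ (∀ x, 0 ≤ ρ x) ∧ (∀ x, ρ x ≤ 1) ∧
    ∀ x, ε ≤ |x| → ρ x = 0 := by
  let f : ContDiffBump (0 : ℝ) := ⟨ε / 2, ε, by positivity, by linarith⟩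
  refine ⟨f, f.contDiff, f.hasCompactSupport, fun x hx => ?_, fun x => f.nonneg, fun x => f.le_one,
    fun x hx => ?_⟩
  · exact f.one_of_mem_closedBall (by simpa [Real.dist_eq] using hx)
  · exact f.zero_of_le_dist (by simpa [Real.dist_eq] using hx)

lemma hasCompactSupport_of_forall_le_abs {f : ℝ → ℂ} {R : ℝ} (h : ∀ x, R ≤ |x| → f x = 0) :
    HasCompactSupport f := by
  refine HasCompactSupport.intro (isCompact_Icc (a := -R) (b := R)) fun x hx => h x ?_
  by_contra! hlt
  have := abs_lt.1 hlt
  exact hx ⟨this.1.le, this.2.le⟩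

/-- A compactly supported Schwartz function with values in `[0, 1]`, supported in `(-ε, ε)` and
equal to one at the origin. -/
lemma exists_schwartz_bump {ε : ℝ} (hε : 0 < ε) : ∃ χ : 𝓢(ℝ, ℂ), HasCompactSupport χ ∧ χ 0 = 1 ∧
    (∀ x, ‖χ x‖ ≤ 1) ∧ ∀ x, ε ≤ |x| → χ x = 0 := by
  obtain ⟨ρ, hρ, hρc, hρ1, hρ0, hρle, hρs⟩ := exists_smooth_cutoff hε
  have hc : HasCompactSupport fun x => (ρ x : ℂ) := hρc.comp_left (g := Complex.ofReal) rfl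
  refine ⟨hc.toSchwartzMap (Complex.ofRealCLM.contDiff.comp hρ), hc, ?_, fun x => ?_, fun x hx => ?_⟩
  · change (ρ 0 : ℂ) = 1
    rw [hρ1 0 (by simp; positivity), Complex.ofReal_one]
  · change ‖(ρ x : ℂ)‖ ≤ 1
    rw [Complex.norm_real, Real.norm_of_nonneg (hρ0 x)]
    exact hρle x
  · change (ρ x : ℂ) = 0
    rw [hρs x hx, Complex.ofReal_zero]

lemma SchwartzMap.exists_seminorm_translate_le (χ : 𝓢(ℝ, ℂ)) (s : Finset (ℕ × ℕ)) :
    ∃ (k : ℕ) (C : ℝ), 0 ≤ C ∧ ∀ y : ℝ, s.sup (schwartzSeminormFamily ℂ ℝ ℂ)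
      (SchwartzMap.compSubConstCLM ℂ y χ) ≤ C * (1 + |y|) ^ k := by
  let A : ℕ × ℕ → ℝ := fun m =>
    2 ^ m.1 * ((Finset.Iic m).sup fun m => SchwartzMap.seminorm ℂ m.1 m.2) χ
  have hA : ∀ m, 0 ≤ A m := fun m => by positivity
  refine ⟨s.sup Prod.fst, ∑ m ∈ s, A m, Finset.sum_nonneg fun m _ => hA m, fun y => ?_⟩
  refine Seminorm.finset_sup_apply_le
    (mul_nonneg (Finset.sum_nonneg fun m _ => hA m) (by positivity)) fun m hm => ?_
  have h1y : 1 ≤ 1 + |y| := by linarith [abs_nonneg y]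
  have h1 : A m * (1 + |y|) ^ m.1 ≤ (∑ m ∈ s, A m) * (1 + |y|) ^ (s.sup Prod.fst) := by
    refine mul_le_mul (Finset.single_le_sum (fun m _ => hA m) hm)
      (pow_le_pow_right₀ h1y (Finset.le_sup (f := Prod.fst) hm)) (by positivity)
      (Finset.sum_nonneg fun m _ => hA m)
  refine le_trans ?_ h1
  refine SchwartzMap.seminorm_le_bound' ℂ m.1 m.2 _ (mul_nonneg (hA m) (by positivity)) fun x => ?_
  have e : (⇑(SchwartzMap.compSubConstCLM ℂ y χ) : ℝ → ℂ) = fun z => χ (z - y) := by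
    ext z; exact SchwartzMap.compSubConstCLM_apply χ y z
  rw [e, iteratedDeriv_comp_sub_const]
  have h2 := SchwartzMap.one_add_le_sup_seminorm_apply (𝕜 := ℂ) (m := m) (k := m.1) (n := m.2)
    le_rfl le_rfl χ (x - y)
  rw [norm_iteratedFDeriv_eq_norm_iteratedDeriv, Real.norm_eq_abs] at h2
  have h3 : |x| ≤ (1 + |x - y|) * (1 + |y|) := by
    have : |x| ≤ |x - y| + |y| := by simpa using abs_add_le (x - y) y
    nlinarith [abs_nonneg (x - y), abs_nonneg y]
  calc |x| ^ m.1 * ‖iteratedDeriv m.2 χ (x - y)‖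
      ≤ ((1 + |x - y|) * (1 + |y|)) ^ m.1 * ‖iteratedDeriv m.2 χ (x - y)‖ := by gcongr
    _ = ((1 + |x - y|) ^ m.1 * ‖iteratedDeriv m.2 χ (x - y)‖) * (1 + |y|) ^ m.1 := by
        rw [mul_pow]; ring
    _ ≤ A m * (1 + |y|) ^ m.1 := by gcongr

lemma TemperedDistribution.exists_seminorm_bound (T : 𝓢'(ℝ, ℂ)) :
    ∃ (s : Finset (ℕ × ℕ)) (C : ℝ), 0 ≤ C ∧
      ∀ φ, ‖T φ‖ ≤ C * s.sup (schwartzSeminormFamily ℂ ℝ ℂ) φ := by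
  let q : Seminorm ℂ 𝓢(ℝ, ℂ) := (normSeminorm ℂ ℂ).comp
    ({ toFun := T, map_add' := map_add T, map_smul' := map_smul T } : 𝓢(ℝ, ℂ) →ₗ[ℂ] ℂ)
  have hT : Continuous T := by fun_prop
  obtain ⟨s, C, -, hle⟩ := Seminorm.bound_of_continuous (schwartz_withSeminorms ℂ ℝ ℂ) q hT.norm
  exact ⟨s, C, C.2, fun φ => hle φ⟩

/-- The product is supported where `t * |x| ≥ 1`, so one additional power of `|x|` buys the factor
`t`. -/
lemma SchwartzMap.seminorm_dilate_smul_le {η : ℝ → ℝ} (hη : ContDiff ℝ ∞ η)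
    (hη0 : ∀ x, |x| < 1 → η x = 0) {M : ℕ → ℝ} (hM : ∀ i x, ‖iteratedDeriv i η x‖ ≤ M i)
    (φ ψ : 𝓢(ℝ, ℂ)) {t : ℝ} (ht0 : 0 < t) (ht1 : t ≤ 1) (hψ : ∀ x, ψ x = η (t * x) • φ x)
    (k n : ℕ) : SchwartzMap.seminorm ℂ k n ψ ≤ t * ∑ i ∈ Finset.range (n + 1),
      (n.choose i : ℝ) * M i * SchwartzMap.seminorm ℂ (k + 1) (n - i) φ := by
  have hM0 : ∀ i, 0 ≤ M i := fun i => (norm_nonneg _).trans (hM i 0)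
  have hB : 0 ≤ t * ∑ i ∈ Finset.range (n + 1), (n.choose i : ℝ) * M i *
      SchwartzMap.seminorm ℂ (k + 1) (n - i) φ :=
    mul_nonneg ht0.le (Finset.sum_nonneg fun i _ => mul_nonneg (mul_nonneg (Nat.cast_nonneg _)
      (hM0 i)) (apply_nonneg _ _))
  have e : (⇑ψ : ℝ → ℂ) = fun x => η (t * x) • φ x := funext hψ
  refine SchwartzMap.seminorm_le_bound ℂ k n _ hB fun x => ?_
  rw [e]
  by_cases hx : |t * x| < 1
  · have hloc : (fun x => η (t * x) • φ x) =ᶠ[𝓝 x] fun _ => 0 := by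
      have hopen : IsOpen {y : ℝ | |t * y| < 1} := isOpen_lt (by fun_prop) continuous_const
      filter_upwards [hopen.mem_nhds hx] with y hy
      rw [hη0 _ hy, zero_smul]
    have h0 := (hloc.iteratedFDeriv ℝ n).eq_of_nhds
    rw [h0]
    simpa using hB
  · push Not at hx
    rw [abs_mul, abs_of_pos ht0] at hx
    have hcomp : ContDiff ℝ ∞ fun x => η (t * x) := hη.comp (contDiff_const.mul contDiff_id)
    have h1 := norm_iteratedFDeriv_smul_le (𝕜 := ℝ) (N := ∞) (n := n)
      (f := fun x => η (t * x)) (g := φ) hcomp (φ.smooth ⊤) x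
      (by exact_mod_cast le_top)
    have hd : ∀ i, ‖iteratedFDeriv ℝ i (fun x => η (t * x)) x‖ ≤ M i := fun i => by
      rw [norm_iteratedFDeriv_eq_norm_iteratedDeriv,
        iteratedDeriv_comp_const_mul (hη.of_le (by exact_mod_cast le_top)), norm_mul,
        norm_pow, Real.norm_of_nonneg ht0.le]
      calc t ^ i * ‖iteratedDeriv i η (t * x)‖ ≤ 1 * M i :=
            mul_le_mul (pow_le_one₀ ht0.le ht1) (hM i _) (norm_nonneg _) zero_le_one
        _ = M i := one_mul _
    rw [Real.norm_eq_abs]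
    have h2 : ‖iteratedFDeriv ℝ n (fun x => η (t * x) • φ x) x‖ ≤
        ∑ i ∈ Finset.range (n + 1), (n.choose i : ℝ) * M i * ‖iteratedFDeriv ℝ (n - i) φ x‖ := by
      refine h1.trans (Finset.sum_le_sum fun i _ => ?_)
      exact mul_le_mul_of_nonneg_right (mul_le_mul_of_nonneg_left (hd i) (Nat.cast_nonneg _))
        (norm_nonneg _)
    have h3 : 0 ≤ |x| ^ k * ∑ i ∈ Finset.range (n + 1), (n.choose i : ℝ) * M i *
        ‖iteratedFDeriv ℝ (n - i) φ x‖ :=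
      mul_nonneg (by positivity) (Finset.sum_nonneg fun i _ => mul_nonneg (mul_nonneg
        (Nat.cast_nonneg _) (hM0 i)) (norm_nonneg _))
    calc |x| ^ k * ‖iteratedFDeriv ℝ n (fun x => η (t * x) • φ x) x‖
        ≤ |x| ^ k * ∑ i ∈ Finset.range (n + 1), (n.choose i : ℝ) * M i *
            ‖iteratedFDeriv ℝ (n - i) φ x‖ := mul_le_mul_of_nonneg_left h2 (by positivity)
      _ ≤ (t * |x|) * (|x| ^ k * ∑ i ∈ Finset.range (n + 1), (n.choose i : ℝ) * M i *
            ‖iteratedFDeriv ℝ (n - i) φ x‖) := le_mul_of_one_le_left h3 hx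
      _ = t * ∑ i ∈ Finset.range (n + 1), (n.choose i : ℝ) * M i *
            (|x| ^ (k + 1) * ‖iteratedFDeriv ℝ (n - i) φ x‖) := by
          rw [Finset.mul_sum, Finset.mul_sum, Finset.mul_sum]
          exact Finset.sum_congr rfl fun i _ => by ring
      _ ≤ _ := by
          refine mul_le_mul_of_nonneg_left (Finset.sum_le_sum fun i _ => ?_) ht0.le
          exact mul_le_mul_of_nonneg_left (SchwartzMap.le_seminorm ℂ (k + 1) (n - i) φ x)
            (mul_nonneg (Nat.cast_nonneg _) (hM0 i))

lemma exists_iteratedDeriv_one_sub_le {ρ : ℝ → ℝ} (hρ : ContDiff ℝ ∞ ρ)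
    (hρc : HasCompactSupport ρ) (i : ℕ) :
    ∃ M, ∀ x, ‖iteratedDeriv i (fun x => 1 - ρ x) x‖ ≤ M := by
  obtain ⟨M, -, hM⟩ := (hρc.toSchwartzMap hρ).decay 0 i
  have hM' : ∀ x, ‖iteratedDeriv i ρ x‖ ≤ M := fun x => by
    have := hM x
    rwa [pow_zero, one_mul, norm_iteratedFDeriv_eq_norm_iteratedDeriv] at this
  rcases Nat.eq_zero_or_pos i with rfl | hi
  · refine ⟨1 + M, fun x => ?_⟩
    have := hM' x
    rw [iteratedDeriv_zero] at *
    exact (norm_sub_le _ _).trans (by simpa using this)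
  · refine ⟨M, fun x => ?_⟩
    rw [iteratedDeriv_const_sub hi, iteratedDeriv_neg, norm_neg]
    exact hM' x

/-- Every Schwartz function is the limit of its products with dilated cutoff functions. -/
lemma SchwartzMap.exists_tendsto_hasCompactSupport (φ : 𝓢(ℝ, ℂ)) : ∃ u : ℕ → 𝓢(ℝ, ℂ),
    (∀ n, HasCompactSupport (u n)) ∧ (∀ n x, ‖u n x‖ ≤ ‖φ x‖) ∧
    (∀ x, Tendsto (fun n => u n x) atTop (𝓝 (φ x))) ∧ Tendsto u atTop (𝓝 φ) := by
  -- With `ε = 2` the function `1 - ρ` vanishes on `(-1, 1)`, as the dilation estimate requires.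
  obtain ⟨ρ, hρ, hρc, hρ1, hρ0, hρle, hρs⟩ := exists_smooth_cutoff (ε := 2) two_pos
  let t : ℕ → ℝ := fun n => 1 / ((n : ℝ) + 1)
  have ht0 : ∀ n, 0 < t n := fun n => by positivity
  have ht1 : ∀ n, t n ≤ 1 := fun n => by
    rw [div_le_one (by positivity)]; linarith [(Nat.cast_nonneg n : (0 : ℝ) ≤ n)]
  have ht : Tendsto t atTop (𝓝 0) := tendsto_one_div_add_atTop_nhds_zero_nat
  have hsmooth : ∀ n, ContDiff ℝ ∞ fun x => ρ (t n * x) := fun n =>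
    hρ.comp (contDiff_const.mul contDiff_id)
  have hcomp : ∀ n, HasCompactSupport fun x => ρ (t n * x) • φ x := fun n =>
    hasCompactSupport_of_forall_le_abs (R := 2 / t n) fun x hx => by
      rw [div_le_iff₀ (ht0 n)] at hx
      rw [hρs, zero_smul]
      rwa [abs_mul, abs_of_pos (ht0 n), mul_comm]
  have hex : ∀ n, ∃ u : 𝓢(ℝ, ℂ), ∀ x, u x = ρ (t n * x) • φ x := fun n =>
    ⟨(hcomp n).toSchwartzMap ((hsmooth n).smul (φ.smooth ⊤)), fun x => rfl⟩
  choose u hu using hex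
  choose M hM using exists_iteratedDeriv_one_sub_le hρ hρc
  refine ⟨u, fun n => ?_, fun n x => ?_, fun x => ?_, ?_⟩
  · rw [show (⇑(u n) : ℝ → ℂ) = fun x => ρ (t n * x) • φ x from funext (hu n)]
    exact hcomp n
  · rw [hu, norm_smul, Real.norm_of_nonneg (hρ0 _)]
    exact mul_le_of_le_one_left (norm_nonneg _) (hρle _)
  · have h0 : Tendsto (fun n => t n * x) atTop (𝓝 (0 * x)) := ht.mul_const x
    rw [zero_mul] at h0
    have h1 : ∀ᶠ n in atTop, |t n * x| < 1 := by
      have := h0.abs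
      rw [abs_zero] at this
      exact this.eventually (gt_mem_nhds one_pos)
    refine tendsto_const_nhds.congr' ?_
    filter_upwards [h1] with n hn
    rw [hu, hρ1 _ (by linarith), one_smul]
  · rw [(schwartz_withSeminorms ℂ ℝ ℂ).tendsto_nhds]
    rintro ⟨k, n⟩ ε hε
    have hlim := ht.mul_const (∑ i ∈ Finset.range (n + 1), (n.choose i : ℝ) * M i *
      SchwartzMap.seminorm ℂ (k + 1) (n - i) φ)
    rw [zero_mul] at hlim
    filter_upwards [hlim.eventually (gt_mem_nhds hε)] with N hN
    rw [schwartzSeminormFamily_apply, map_sub_rev]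
    refine (SchwartzMap.seminorm_dilate_smul_le (η := fun x => 1 - ρ x) (contDiff_const.sub hρ)
      (fun x hx => ?_) hM φ (φ - u N) (ht0 N) (ht1 N) (fun x => ?_) k n).trans_lt hN
    · rw [hρ1 x (by linarith), sub_self]
    · rw [sub_apply, hu, sub_smul, one_smul]

/-! ### Discrete measures as tempered distributions -/

lemma IsUniformlyDiscrete.countable {Λ : Set ℝ} (h : IsUniformlyDiscrete Λ) : Λ.Countable := by
  have : Λ = ⋃ n : ℕ, Λ ∩ Set.Icc (-(n : ℝ)) n := by
    ext x
    simp only [Set.mem_iUnion, Set.mem_inter_iff, Set.mem_Icc]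
    refine ⟨fun hx => ?_, fun ⟨n, hx⟩ => hx.1⟩
    obtain ⟨n, hn⟩ := exists_nat_ge |x|
    exact ⟨n, hx, abs_le.1 hn⟩
  rw [this]
  exact Set.countable_iUnion fun n => (h.translationBounded.finite_inter one_pos _).countable

/-- The bound is uniform in the centre `y`: rounding `(x - y) / d` down is injective on `Λ`, which
compares the sum with one over the integers. The shift by `1 / 2` avoids a zero denominator. -/
lemma IsUniformlyDiscrete.exists_tsum_le {Λ : Set ℝ} (h : IsUniformlyDiscrete Λ) :
    ∃ C, ∀ y : ℝ, (Summable fun x : Λ => 1 / (1 + |(x : ℝ) - y|) ^ 2) ∧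
      ∑' x : Λ, 1 / (1 + |(x : ℝ) - y|) ^ 2 ≤ C := by
  obtain ⟨d, hd, hsep⟩ := h
  have hs : Summable fun n : ℤ => 1 / |(n : ℝ) + 1 / 2| ^ (2 : ℝ) :=
    (Real.summable_one_div_int_add_rpow (1 / 2) 2).2 (by norm_num)
  refine ⟨(2 + 1 / d) ^ 2 * ∑' n : ℤ, 1 / |(n : ℝ) + 1 / 2| ^ (2 : ℝ), fun y => ?_⟩
  have hinj : Function.Injective fun x : Λ => ⌊((x : ℝ) - y) / d⌋ := by
    intro x z hxz
    by_contra hne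
    have h1 := hsep x x.2 z z.2 (Subtype.val_injective.ne hne)
    have h2 := Int.abs_sub_lt_one_of_floor_eq_floor hxz
    rw [← sub_div, abs_div, abs_of_pos hd, div_lt_one hd, sub_sub_sub_cancel_right] at h2
    linarith
  have hle : ∀ x : Λ, 1 / (1 + |(x : ℝ) - y|) ^ 2 ≤
      (2 + 1 / d) ^ 2 * (1 / |(⌊((x : ℝ) - y) / d⌋ : ℝ) + 1 / 2| ^ (2 : ℝ)) := by
    intro x
    rw [Real.rpow_two]
    set n := ⌊((x : ℝ) - y) / d⌋
    have hn1 : (n : ℝ) ≤ (x - y) / d := Int.floor_le _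
    have hn2 : ((x : ℝ) - y) / d < n + 1 := Int.lt_floor_add_one _
    have hpos : 0 < |(n : ℝ) + 1 / 2| := by
      rw [abs_pos]
      intro h0
      have h1 : (2 * n + 1 : ℤ) = 0 := by
        have : (2 * n + 1 : ℝ) = 0 := by linarith
        exact_mod_cast this
      omega
    have hle : |(n : ℝ) + 1 / 2| ≤ (2 + 1 / d) * (1 + |(x : ℝ) - y|) := by
      have h1 : |((x : ℝ) - y) / d| = 1 / d * |(x : ℝ) - y| := by
        rw [abs_div, abs_of_pos hd]; ring
      have h2 : |(n : ℝ) + 1 / 2| ≤ |((x : ℝ) - y) / d| + 1 := by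
        have h3 := abs_le.1 (le_refl |((x : ℝ) - y) / d|)
        rw [abs_le]
        constructor <;> linarith [h3.1, h3.2]
      rw [h1] at h2
      have h3 : 0 < 1 / d := by positivity
      nlinarith [abs_nonneg ((x : ℝ) - y)]
    rw [mul_one_div, div_le_div_iff₀ (by positivity) (by positivity), one_mul, ← mul_pow]
    gcongr
  have hs' := (hs.comp_injective hinj).mul_left ((2 + 1 / d) ^ 2)
  have hsum := Summable.of_nonneg_of_le (fun x : Λ => by positivity) hle hs'
  refine ⟨hsum, (hsum.tsum_le_tsum hle hs').trans ?_⟩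
  rw [tsum_mul_left]
  gcongr
  exact tsum_comp_le_tsum_of_inj hs (fun n => by positivity) hinj

section Measure

variable {T : 𝓢'(ℝ, ℂ)} {Λ : Set ℝ} {c : Λ → ℂ}

lemma hasSum_single_of_separated {d ε : ℝ} (hsep : ∀ x ∈ Λ, ∀ y ∈ Λ, x ≠ y → d ≤ |x - y|)
    {f : ℝ → ℂ} {y : ℝ} (hf : ∀ z, ε ≤ |z| → f z = 0) (x : Λ)
    (hx : |(x : ℝ) - y| ≤ d - ε) : HasSum (fun z : Λ => c z * f (z - y)) (c x * f (x - y)) := by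
  refine hasSum_single x fun z hz => ?_
  rw [hf, mul_zero]
  have h1 := hsep z z.2 x x.2 (Subtype.val_injective.ne hz)
  have h2 : |(z : ℝ) - x| ≤ |(z : ℝ) - y| + |(x : ℝ) - y| := by
    rw [abs_sub_comm (x : ℝ) y]
    exact abs_sub_le _ _ _
  linarith

/-- A bump of width `d` translated to `x` sees only the mass at `x`, and its seminorms grow
polynomially in `x`. -/
lemma IsDiscreteMeasure.exists_mass_le (h : IsDiscreteMeasure T Λ c) :
    ∃ (k : ℕ) (C : ℝ), 0 ≤ C ∧ ∀ x : Λ, ‖c x‖ ≤ C * (1 + |(x : ℝ)|) ^ k := by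
  obtain ⟨d, hd, hsep⟩ := h.uniformlyDiscrete
  obtain ⟨χ, hχc, hχ0, -, hχs⟩ := exists_schwartz_bump hd
  obtain ⟨s, C, hC, hT⟩ := T.exists_seminorm_bound
  obtain ⟨k, C', hC', hχ⟩ := χ.exists_seminorm_translate_le s
  refine ⟨k, C * C', by positivity, fun x => ?_⟩
  have hcomp : HasCompactSupport (SchwartzMap.compSubConstCLM ℂ (x : ℝ) χ) :=
    hasCompactSupport_of_forall_le_abs (R := |(x : ℝ)| + d) fun z hz => by
      rw [SchwartzMap.compSubConstCLM_apply]
      exact hχs _ (by linarith [abs_sub_abs_le_abs_sub z x])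
  have h1 := h.hasSum _ hcomp
  simp only [SchwartzMap.compSubConstCLM_apply] at h1
  have h2 := hasSum_single_of_separated (c := c) (y := x) hsep hχs x (by simp)
  rw [sub_self, hχ0, mul_one] at h2
  rw [← h1.unique h2]
  calc _ ≤ C * s.sup (schwartzSeminormFamily ℂ ℝ ℂ) (SchwartzMap.compSubConstCLM ℂ (x : ℝ) χ) :=
        hT _
    _ ≤ C * (C' * (1 + |(x : ℝ)|) ^ k) := by gcongr; exact hχ x
    _ = _ := by ring

lemma IsDiscreteMeasure.summable_norm (h : IsDiscreteMeasure T Λ c) (φ : 𝓢(ℝ, ℂ)) :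
    Summable fun x : Λ => ‖c x * φ x‖ := by
  obtain ⟨k, C, hC, hc⟩ := h.exists_mass_le
  have hφ := fun x => SchwartzMap.one_add_le_sup_seminorm_apply (𝕜 := ℂ) (m := (k + 2, 0))
    (k := k + 2) (n := 0) le_rfl le_rfl φ x
  set B := 2 ^ (k + 2) * ((Finset.Iic (k + 2, 0)).sup fun m => SchwartzMap.seminorm ℂ m.1 m.2) φ
  obtain ⟨_, hsum⟩ := h.uniformlyDiscrete.exists_tsum_le
  have hsum' := (hsum 0).1
  simp only [sub_zero] at hsum'
  refine Summable.of_nonneg_of_le (fun _ => norm_nonneg _) (fun x => ?_) (hsum'.mul_left (C * B))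
  have h1 : (1 + |(x : ℝ)|) ^ (k + 2) * ‖φ x‖ ≤ B := by
    simpa using hφ x
  have h0 : 0 < 1 + |(x : ℝ)| := by positivity
  rw [norm_mul, mul_one_div, le_div_iff₀ (by positivity)]
  calc ‖c x‖ * ‖φ x‖ * (1 + |(x : ℝ)|) ^ 2
      ≤ (C * (1 + |(x : ℝ)|) ^ k) * ‖φ x‖ * (1 + |(x : ℝ)|) ^ 2 := by gcongr; exact hc x
    _ = C * ((1 + |(x : ℝ)|) ^ (k + 2) * ‖φ x‖) := by ring
    _ ≤ C * B := by gcongr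

/-- Polynomial growth of the masses allows dominated convergence along compactly supported
approximations, which removes the restriction on test functions. -/
lemma IsDiscreteMeasure.hasSum_schwartz (h : IsDiscreteMeasure T Λ c) (φ : 𝓢(ℝ, ℂ)) :
    HasSum (fun x : Λ => c x * φ x) (T φ) := by
  obtain ⟨u, huc, hule, hupt, hu⟩ := φ.exists_tendsto_hasCompactSupport
  have hT : Continuous T := by fun_prop
  have h1 : Tendsto (fun n => T (u n)) atTop (𝓝 (T φ)) := (hT.tendsto φ).comp hu
  have h2 : Tendsto (fun n => ∑' x : Λ, c x * u n x) atTop (𝓝 (∑' x : Λ, c x * φ x)) := by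
    refine tendsto_tsum_of_dominated_convergence (h.summable_norm φ)
      (fun x => (hupt x).const_mul _) (Eventually.of_forall fun n x => ?_)
    rw [norm_mul, norm_mul]
    gcongr
    exact hule n x
  have h3 : ∀ n, ∑' x : Λ, c x * u n x = T (u n) := fun n => (h.hasSum _ (huc n)).tsum_eq
  simp_rw [h3] at h2
  rw [tendsto_nhds_unique h1 h2]
  exact (h.summable_norm φ).of_norm.hasSum

end Measure

/-! ### Poisson summation, bounded masses and relative density -/

lemma SchwartzMap.fourier_apply_eq_integral (φ : 𝓢(ℝ, ℂ)) (w : ℝ) :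
    𝓕 φ w = ∫ v, cexpTwoPi (-(w * v)) * φ v := by
  rw [SchwartzMap.fourier_coe, Real.fourier_real_eq_integral_exp_smul]
  congr 1
  ext v
  rw [cexpTwoPi, smul_eq_mul]
  congr 2
  push_cast
  ring

lemma SchwartzMap.fourierInv_apply_eq_integral (φ : 𝓢(ℝ, ℂ)) (w : ℝ) :
    𝓕⁻ φ w = ∫ v, cexpTwoPi (w * v) * φ v := by
  rw [SchwartzMap.fourierInv_coe, Real.fourierInv_eq']
  congr 1
  ext v
  rw [cexpTwoPi, smul_eq_mul]
  congr 2
  simp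

lemma SchwartzMap.fourier_translate (φ : 𝓢(ℝ, ℂ)) (t w : ℝ) :
    𝓕 (SchwartzMap.compSubConstCLM ℂ t φ) w = cexpTwoPi (-(t * w)) * 𝓕 φ w := by
  rw [SchwartzMap.fourier_apply_eq_integral, SchwartzMap.fourier_apply_eq_integral,
    ← MeasureTheory.integral_const_mul, ← MeasureTheory.integral_add_right_eq_self _ t]
  congr 1
  ext v
  rw [SchwartzMap.compSubConstCLM_apply, add_sub_cancel_right, ← mul_assoc, ← cexpTwoPi_add]
  congr 2
  ring

lemma SchwartzMap.fourierInv_translate (φ : 𝓢(ℝ, ℂ)) (t w : ℝ) :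
    𝓕⁻ (SchwartzMap.compSubConstCLM ℂ t φ) w = cexpTwoPi (t * w) * 𝓕⁻ φ w := by
  rw [SchwartzMap.fourierInv_apply_eq_integral, SchwartzMap.fourierInv_apply_eq_integral,
    ← MeasureTheory.integral_const_mul, ← MeasureTheory.integral_add_right_eq_self _ t]
  congr 1
  ext v
  rw [SchwartzMap.compSubConstCLM_apply, add_sub_cancel_right, ← mul_assoc, ← cexpTwoPi_add]
  congr 2
  ring

section Poisson

variable {μ : 𝓢'(ℝ, ℂ)} {Λ S : Set ℝ} {a : Λ → ℂ} {b : S → ℂ}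

/-- The generalized Poisson summation formula. -/
lemma IsDiscreteMeasure.tsum_eq_tsum_fourier (hμ : IsDiscreteMeasure μ Λ a)
    (hν : IsDiscreteMeasure (𝓕 μ) S b) (φ : 𝓢(ℝ, ℂ)) (t : ℝ) :
    ∑' s : S, b s * φ (s - t) = ∑' x : Λ, a x * (cexpTwoPi (-(t * x)) * 𝓕 φ x) := by
  have h1 := (hν.hasSum_schwartz (SchwartzMap.compSubConstCLM ℂ t φ)).tsum_eq
  have h2 := (hμ.hasSum_schwartz (𝓕 (SchwartzMap.compSubConstCLM ℂ t φ))).tsum_eq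
  simp only [SchwartzMap.compSubConstCLM_apply] at h1
  simp only [SchwartzMap.fourier_translate] at h2
  rw [h1, h2, TemperedDistribution.fourier_apply]

lemma IsDiscreteMeasure.tsum_eq_tsum_fourierInv (hμ : IsDiscreteMeasure μ Λ a)
    (hν : IsDiscreteMeasure (𝓕 μ) S b) (χ : 𝓢(ℝ, ℂ)) (y : ℝ) :
    ∑' x : Λ, a x * χ (x - y) = ∑' s : S, b s * (cexpTwoPi (y * s) * 𝓕⁻ χ s) := by
  have h1 := (hμ.hasSum_schwartz (SchwartzMap.compSubConstCLM ℂ y χ)).tsum_eq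
  have h2 := (hν.hasSum_schwartz (𝓕⁻ (SchwartzMap.compSubConstCLM ℂ y χ))).tsum_eq
  simp only [SchwartzMap.compSubConstCLM_apply] at h1
  simp only [SchwartzMap.fourierInv_translate] at h2
  rw [h1, h2, TemperedDistribution.fourier_apply, FourierInvPair.fourier_fourierInv_eq]

/-- Poisson summation improves polynomial growth to boundedness: translating the bump only
multiplies the spectral terms by unimodular factors. -/
lemma IsDiscreteMeasure.exists_mass_bound (hμ : IsDiscreteMeasure μ Λ a)
    (hν : IsDiscreteMeasure (𝓕 μ) S b) : ∃ A, 0 ≤ A ∧ ∀ x, ‖a x‖ ≤ A := by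
  obtain ⟨d, hd, hsep⟩ := hμ.uniformlyDiscrete
  obtain ⟨χ, -, hχ0, -, hχs⟩ := exists_schwartz_bump hd
  refine ⟨∑' s : S, ‖b s * 𝓕⁻ χ s‖, tsum_nonneg fun _ => norm_nonneg _, fun x => ?_⟩
  have h1 := hμ.tsum_eq_tsum_fourierInv hν χ x
  have h2 := hasSum_single_of_separated (c := a) (y := x) hsep hχs x (by simp)
  rw [h2.tsum_eq, sub_self, hχ0, mul_one] at h1
  rw [h1]
  refine tsum_of_norm_bounded (hν.summable_norm (𝓕⁻ χ)).hasSum fun s => ?_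
  rw [norm_mul, norm_mul, norm_cexpTwoPi, one_mul, norm_mul]

lemma SchwartzMap.exists_norm_le_div (φ : 𝓢(ℝ, ℂ)) :
    ∃ B, 0 ≤ B ∧ ∀ x, ‖φ x‖ ≤ B / (1 + |x|) ^ 4 := by
  have hφ := fun x => SchwartzMap.one_add_le_sup_seminorm_apply (𝕜 := ℂ) (m := (4, 0))
    (k := 4) (n := 0) le_rfl le_rfl φ x
  refine ⟨_, (by positivity : 0 ≤ 2 ^ 4 * ((Finset.Iic (4, 0)).sup
    fun m => SchwartzMap.seminorm ℂ m.1 m.2) φ), fun x => ?_⟩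
  have h0 : 0 < 1 + |x| := by positivity
  rw [le_div_iff₀ (by positivity), mul_comm]
  simpa using hφ x

lemma IsDiscreteMeasure.nonempty_fourier (hμ : IsDiscreteMeasure μ Λ a)
    (hν : IsDiscreteMeasure (𝓕 μ) S b) (hΛ : Λ.Nonempty) : S.Nonempty := by
  obtain ⟨x, hx⟩ := hΛ
  by_contra hS
  rw [Set.not_nonempty_iff_eq_empty] at hS
  subst hS
  obtain ⟨d, hd, hsep⟩ := hμ.uniformlyDiscrete
  obtain ⟨χ, -, hχ0, -, hχs⟩ := exists_schwartz_bump hd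
  have h1 := hμ.tsum_eq_tsum_fourierInv hν χ x
  have h2 := hasSum_single_of_separated (c := a) (y := x) hsep hχs ⟨x, hx⟩ (by simp)
  rw [h2.tsum_eq, sub_self, hχ0, mul_one, tsum_empty] at h1
  exact hμ.mass_ne_zero _ h1

/-- The support of a discrete measure with uniformly discrete spectrum is relatively dense. -/
lemma IsDiscreteMeasure.exists_isRelativelyDense (hμ : IsDiscreteMeasure μ Λ a)
    (hν : IsDiscreteMeasure (𝓕 μ) S b) (hΛ : Λ.Nonempty) : ∃ R, IsRelativelyDense Λ R := by
  obtain ⟨s₀, hs₀⟩ := hμ.nonempty_fourier hν hΛ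
  obtain ⟨δ, hδ, hsep⟩ := hν.uniformlyDiscrete
  obtain ⟨φ, -, hφ0, -, hφs⟩ := exists_schwartz_bump hδ
  obtain ⟨A, hA0, hA⟩ := hμ.exists_mass_bound hν
  obtain ⟨C, hC⟩ := hμ.uniformlyDiscrete.exists_tsum_le
  set χ : 𝓢(ℝ, ℂ) := 𝓕 (SchwartzMap.compSubConstCLM ℂ s₀ φ) with hχ
  obtain ⟨B, hB0, hB⟩ := χ.exists_norm_le_div
  -- The inverse transform of `χ` isolates the single frequency `s₀`, so the sum has the same
  -- modulus for every `y`. A large hole of `Λ` around `y` would make it small.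
  have hval : ∀ y : ℝ, ‖∑' x : Λ, a x * χ (x - y)‖ = ‖b ⟨s₀, hs₀⟩‖ := by
    intro y
    rw [hμ.tsum_eq_tsum_fourierInv hν χ y, hχ, FourierPair.fourierInv_fourier_eq]
    simp only [SchwartzMap.compSubConstCLM_apply]
    have h2 := hasSum_single_of_separated (c := fun s => b s * cexpTwoPi (y * s)) (y := s₀) hsep
      hφs ⟨s₀, hs₀⟩ (by simp)
    simp only [mul_assoc] at h2
    rw [h2.tsum_eq, sub_self, hφ0, mul_one, norm_mul, norm_cexpTwoPi, mul_one]
  have hb := norm_pos_iff.2 (hν.mass_ne_zero ⟨s₀, hs₀⟩)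
  have hC0 : 0 ≤ C := (tsum_nonneg fun x : Λ => by positivity).trans (hC 0).2
  have hlim : Tendsto (fun R : ℝ => A * B * C / R) atTop (𝓝 0) :=
    tendsto_const_nhds.div_atTop tendsto_id
  obtain ⟨R, hR, hR1⟩ := ((hlim.eventually (gt_mem_nhds hb)).and (eventually_ge_atTop 1)).exists
  refine ⟨R, fun y => ?_⟩
  by_contra! hfar
  have hterm : ∀ x : Λ, ‖a x * χ (x - y)‖ ≤ A * B / R * (1 / (1 + |(x : ℝ) - y|) ^ 2) := by
    intro x
    have hx := hfar x x.2
    have h0 : 0 < 1 + |(x : ℝ) - y| := by positivity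
    rw [norm_mul]
    calc ‖a x‖ * ‖χ (x - y)‖ ≤ A * (B / (1 + |(x : ℝ) - y|) ^ 4) := by
          gcongr
          · exact hA x
          · exact hB _
      _ = A * B / (1 + |(x : ℝ) - y|) ^ 2 * (1 / (1 + |(x : ℝ) - y|) ^ 2) := by
          field_simp
      _ ≤ A * B / R * (1 / (1 + |(x : ℝ) - y|) ^ 2) := by
          gcongr
          nlinarith
  have h1 := tsum_of_norm_bounded ((hC y).1.hasSum.mul_left (A * B / R)) hterm
  rw [hval] at h1
  have h2 : A * B / R * ∑' x : Λ, 1 / (1 + |(x : ℝ) - y|) ^ 2 ≤ A * B / R * C := by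
    gcongr
    exact (hC y).2
  have h3 : A * B / R * C = A * B * C / R := by ring
  linarith

end Poisson

/-! ### Correlations of the measure with its translates -/

lemma conj_cexpTwoPi (x : ℝ) : (starRingEnd ℂ) (cexpTwoPi x) = cexpTwoPi (-x) := by
  have e : ∀ x : ℝ, cexpTwoPi x = Complex.exp ((2 * Real.pi * x : ℝ) * Complex.I) := fun x => by
    rw [cexpTwoPi]; push_cast; rfl
  rw [e, e, ← Complex.exp_conj, map_mul, Complex.conj_ofReal, Complex.conj_I]
  congr 1
  push_cast
  ring

lemma SpectrumVanishes.restrict {Λ Λ' : Set ℝ} (hsub : Λ' ⊆ Λ) {W : ℝ → ℂ}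
    (hW : ∀ x, x ∉ Λ' → W x = 0) {τ : ℝ}
    (h : SpectrumVanishes (Subtype.val : Λ → ℝ) (fun x => W x) τ) :
    SpectrumVanishes (Subtype.val : Λ' → ℝ) (fun x => W x) τ := by
  intro t ht
  have key : ∀ X : Set ℝ, Λ' ⊆ X →
      ∑' x : X, W x * cexpTwoPi (t * x) = ∑' x, W x * cexpTwoPi (t * x) := fun X hX =>
    tsum_subtype_eq_of_support_subset (f := fun x => W x * cexpTwoPi (t * x)) fun x hx => by
      by_contra hx'
      exact hx (by simp [hW x fun h => hx' (hX h)])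
  rw [key Λ' le_rfl, ← key Λ hsub]
  exact h t ht

/-- Extension by zero of a function defined on a set of real numbers. -/
noncomputable def zeroExtend {Λ : Set ℝ} (a : Λ → ℂ) : ℝ → ℂ :=
  Function.extend Subtype.val a 0

lemma zeroExtend_apply {Λ : Set ℝ} (a : Λ → ℂ) (x : Λ) : zeroExtend a x = a x :=
  Subtype.val_injective.extend_apply _ _ _

lemma zeroExtend_of_notMem {Λ : Set ℝ} (a : Λ → ℂ) {x : ℝ} (hx : x ∉ Λ) : zeroExtend a x = 0 :=
  Function.extend_apply' _ _ _ fun ⟨y, hy⟩ => hx (hy ▸ y.2)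

section Bump

variable {Λ : Set ℝ} {a : Λ → ℂ} {d : ℝ}

/-- The sum of a measure with separated support against a bump around `y` has at most one term. -/
lemma tsum_bump_eq (hsep : ∀ x ∈ Λ, ∀ y ∈ Λ, x ≠ y → d ≤ |x - y|) {f : ℝ → ℂ} {ε : ℝ}
    (hε : ε ≤ d / 2) (hf : ∀ z, ε ≤ |z| → f z = 0) (y : ℝ) :
    ∑' x : Λ, a x * f (x - y) = 0 ∨
      ∃ x : Λ, |(x : ℝ) - y| < ε ∧ ∑' x : Λ, a x * f (x - y) = a x * f (x - y) := by
  by_cases h : ∃ x : Λ, |(x : ℝ) - y| < ε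
  · obtain ⟨x, hx⟩ := h
    exact Or.inr ⟨x, hx, (hasSum_single_of_separated hsep hf x (by linarith)).tsum_eq⟩
  · push Not at h
    refine Or.inl ?_
    have : ∀ x : Λ, a x * f (x - y) = 0 := fun x => by rw [hf _ (h x), mul_zero]
    simp [this]

lemma norm_tsum_bump_le (hsep : ∀ x ∈ Λ, ∀ y ∈ Λ, x ≠ y → d ≤ |x - y|) {f : ℝ → ℂ} {ε : ℝ}
    (hε : ε ≤ d / 2) (hf : ∀ z, ε ≤ |z| → f z = 0) (hf1 : ∀ z, ‖f z‖ ≤ 1) {A : ℝ} (hA0 : 0 ≤ A)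
    (hA : ∀ x, ‖a x‖ ≤ A) (y : ℝ) : ‖∑' x : Λ, a x * f (x - y)‖ ≤ A := by
  rcases tsum_bump_eq (a := a) hsep hε hf y with h | ⟨x, -, h⟩
  · rw [h, norm_zero]; exact hA0
  · rw [h, norm_mul]
    calc ‖a x‖ * ‖f (x - y)‖ ≤ A * 1 :=
          mul_le_mul (hA x) (hf1 _) (norm_nonneg _) hA0
      _ = A := mul_one A

/-- Testing a measure with separated support against shrinking bumps around `y` gives its mass
at `y`. -/
lemma tendsto_tsum_bump (hsep : ∀ x ∈ Λ, ∀ y ∈ Λ, x ≠ y → d ≤ |x - y|) {f : ℕ → ℝ → ℂ}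
    {ε : ℕ → ℝ} (hε : ∀ n, ε n ≤ d / 2) (hεlim : Tendsto ε atTop (𝓝 0))
    (hf : ∀ n z, ε n ≤ |z| → f n z = 0) (hf0 : ∀ n, f n 0 = 1) (y : ℝ) (hd : 0 < d) :
    Tendsto (fun n => ∑' x : Λ, a x * f n (x - y)) atTop (𝓝 (zeroExtend a y)) := by
  by_cases hy : y ∈ Λ
  · refine tendsto_const_nhds.congr fun n => ?_
    have := (hasSum_single_of_separated (c := a) (y := y) hsep (hf n) ⟨y, hy⟩
      (by simp; linarith [hε n])).tsum_eq
    rw [this, sub_self, hf0, mul_one]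
    exact zeroExtend_apply a ⟨y, hy⟩
  · rw [zeroExtend_of_notMem a hy]
    by_cases h : ∃ x : Λ, |(x : ℝ) - y| < d / 2
    · obtain ⟨x, hx⟩ := h
      have hpos : 0 < |(x : ℝ) - y| := abs_pos.2 (sub_ne_zero.2 fun h => hy (h ▸ x.2))
      refine tendsto_const_nhds.congr' ?_
      filter_upwards [hεlim.eventually (gt_mem_nhds hpos)] with n hn
      rw [(hasSum_single_of_separated hsep (hf n) x (by linarith [hε n])).tsum_eq,
        hf n _ hn.le, mul_zero]
    · push Not at h
      refine tendsto_const_nhds.congr fun n => ?_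
      have : ∀ x : Λ, a x * f n (x - y) = 0 := fun x => by
        rw [hf n _ ((hε n).trans (h x)), mul_zero]
      simp [this]

end Bump

/-- A sequence of bumps around the origin whose supports shrink to the origin. -/
lemma exists_seq_schwartz_bump {d : ℝ} (hd : 0 < d) : ∃ (ε : ℕ → ℝ) (χ : ℕ → 𝓢(ℝ, ℂ)),
    (∀ n, ε n ≤ d / 2) ∧ Tendsto ε atTop (𝓝 0) ∧ (∀ n, χ n 0 = 1) ∧ (∀ n x, ‖χ n x‖ ≤ 1) ∧
    ∀ n x, ε n ≤ |x| → χ n x = 0 := by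
  let ε : ℕ → ℝ := fun n => d / 2 * (1 / ((n : ℝ) + 1))
  have hε0 : ∀ n, 0 < ε n := fun n => by positivity
  have hεd : ∀ n, ε n ≤ d / 2 := fun n => by
    refine mul_le_of_le_one_right (by positivity) ?_
    rw [div_le_one (by positivity)]
    linarith [(Nat.cast_nonneg n : (0 : ℝ) ≤ n)]
  have hεlim : Tendsto ε atTop (𝓝 0) := by
    have := (tendsto_one_div_add_atTop_nhds_zero_nat (𝕜 := ℝ)).const_mul (d / 2)
    rwa [mul_zero] at this
  choose χ _ hχ0 hχ1 hχs using fun n => exists_schwartz_bump (hε0 n)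
  exact ⟨ε, χ, hεd, hεlim, hχ0, hχ1, hχs⟩

/-- A Schwartz function supported in `(p - ε, p + ε)` whose Fourier transform does not vanish
at `w`. -/
lemma exists_schwartz_fourier_ne_zero {ε : ℝ} (hε : 0 < ε) (p w : ℝ) : ∃ φ : 𝓢(ℝ, ℂ),
    (∀ x, ε ≤ |x - p| → φ x = 0) ∧ 𝓕 φ w ≠ 0 := by
  obtain ⟨ρ, hρ, hρc, hρ1, hρ0, -, hρs⟩ := exists_smooth_cutoff hε
  -- Modulation by the frequency `w` turns the transform at `w` into the integral of `ρ`, which is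
  -- positive.
  have hsm : ContDiff ℝ ∞ fun x => cexpTwoPi (w * x) * (ρ x : ℂ) := by
    refine ContDiff.mul ?_ (Complex.ofRealCLM.contDiff.comp hρ)
    unfold cexpTwoPi
    refine ContDiff.cexp (ContDiff.mul (contDiff_const.mul ?_) contDiff_const)
    exact Complex.ofRealCLM.contDiff.comp (contDiff_const.mul contDiff_id)
  have hcs : HasCompactSupport fun x => cexpTwoPi (w * x) * (ρ x : ℂ) :=
    hasCompactSupport_of_forall_le_abs (R := ε) fun x hx => by
      rw [hρs x hx, Complex.ofReal_zero, mul_zero]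
  let φ : 𝓢(ℝ, ℂ) := hcs.toSchwartzMap hsm
  have hφ : ∀ x, φ x = cexpTwoPi (w * x) * (ρ x : ℂ) := fun x => rfl
  refine ⟨SchwartzMap.compSubConstCLM ℂ p φ, fun x hx => ?_, ?_⟩
  · rw [SchwartzMap.compSubConstCLM_apply, hφ, hρs _ hx, Complex.ofReal_zero, mul_zero]
  · rw [SchwartzMap.fourier_translate]
    refine mul_ne_zero (cexpTwoPi_ne_zero _) ?_
    rw [SchwartzMap.fourier_apply_eq_integral]
    have e : ∀ v, cexpTwoPi (-(w * v)) * φ v = (ρ v : ℂ) := fun v => by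
      rw [hφ, ← mul_assoc, ← cexpTwoPi_add, neg_add_cancel, cexpTwoPi_zero, one_mul]
    simp_rw [e]
    rw [integral_complex_ofReal, Complex.ofReal_ne_zero]
    refine (hρ.continuous.integral_pos_of_hasCompactSupport_nonneg_nonzero hρc hρ0
      (x := 0) ?_).ne'
    rw [hρ1 0 (by simp; positivity)]
    exact one_ne_zero

section Correlation

variable {μ : 𝓢'(ℝ, ℂ)} {Λ S : Set ℝ} {a : Λ → ℂ} {b : S → ℂ}

/-- If the spectrum `S` is `δ`-separated and `φ` is supported in `(δ / 4, 3 δ / 4)`, the measure with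
masses `a x * 𝓕 φ x` is orthogonal to the translates of the measure with masses `a x`. -/
lemma IsDiscreteMeasure.tsum_correlation_eq_zero (hμ : IsDiscreteMeasure μ Λ a)
    (hν : IsDiscreteMeasure (𝓕 μ) S b) {δ : ℝ} (hδ : 0 < δ)
    (hsep : ∀ x ∈ S, ∀ y ∈ S, x ≠ y → δ ≤ |x - y|) {φ : 𝓢(ℝ, ℂ)}
    (hφ : ∀ x, δ / 4 ≤ |x - δ / 2| → φ x = 0) (χ : 𝓢(ℝ, ℂ)) {t : ℝ} (ht : |t| ≤ δ / 8) :
    ∑' x : Λ, a x * (cexpTwoPi (-(t * x)) * 𝓕 φ x) *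
      (starRingEnd ℂ) (∑' y : Λ, a y * χ (y - x)) = 0 := by
  -- By Poisson summation the terms are `b r * φ (r - s - t)`. As `r - s` is zero or at least `δ` in
  -- modulus, `r - s - t` avoids `(δ/4, 3δ/4)`.
  have hzero : ∀ s : S, ∑' x : Λ, a x * (cexpTwoPi (-((t + s) * x)) * 𝓕 φ x) = 0 := by
    intro s
    rw [← hμ.tsum_eq_tsum_fourier hν φ (t + s)]
    have : ∀ r : S, b r * φ (r - (t + s)) = 0 := by
      intro r
      rw [hφ, mul_zero]
      have ht' := abs_le.1 ht
      by_cases hrs : r = s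
      · rw [hrs, le_abs]
        right
        linarith [ht'.1]
      · have h1 := hsep r r.2 s s.2 (Subtype.val_injective.ne hrs)
        rw [le_abs] at h1 ⊢
        rcases h1 with h1 | h1
        · left; linarith [ht'.2]
        · right; linarith [ht'.1]
    simp [this]
  have hinner : ∀ x : Λ, (starRingEnd ℂ) (∑' y : Λ, a y * χ (y - x)) =
      ∑' s : S, (starRingEnd ℂ) (b s * 𝓕⁻ χ s) * cexpTwoPi (-(s * x)) := by
    intro x
    rw [hμ.tsum_eq_tsum_fourierInv hν χ x, Complex.conj_tsum]
    refine tsum_congr fun s => ?_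
    rw [map_mul, map_mul, conj_cexpTwoPi, mul_comm (x : ℝ), map_mul]
    ring
  simp_rw [hinner, ← tsum_mul_left]
  have h1 : Summable fun x : Λ => ‖a x * (cexpTwoPi (-(t * x)) * 𝓕 φ x)‖ := by
    refine (hμ.summable_norm (𝓕 φ)).congr fun x => ?_
    simp
  have h2 : Summable fun s : S => ‖(starRingEnd ℂ) (b s * 𝓕⁻ χ s)‖ := by
    simpa only [RCLike.norm_conj] using hν.summable_norm (𝓕⁻ χ)
  have h3 : Summable fun p : Λ × S => a p.1 * (cexpTwoPi (-(t * p.1)) * 𝓕 φ p.1) *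
      ((starRingEnd ℂ) (b p.2 * 𝓕⁻ χ p.2) * cexpTwoPi (-(p.2 * p.1))) := by
    refine Summable.of_norm ((h1.mul_of_nonneg h2 (fun _ => norm_nonneg _)
      fun _ => norm_nonneg _).congr fun p => ?_)
    simp
  rw [← Summable.tsum_comm (f := fun (x : Λ) (s : S) => a x * (cexpTwoPi (-(t * x)) * 𝓕 φ x) *
      ((starRingEnd ℂ) (b s * 𝓕⁻ χ s) * cexpTwoPi (-(s * x)))) h3]
  have h4 : ∀ s : S, ∑' x : Λ, a x * (cexpTwoPi (-(t * x)) * 𝓕 φ x) *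
      ((starRingEnd ℂ) (b s * 𝓕⁻ χ s) * cexpTwoPi (-(s * x))) = 0 := by
    intro s
    have e : ∀ x : Λ, a x * (cexpTwoPi (-(t * x)) * 𝓕 φ x) *
        ((starRingEnd ℂ) (b s * 𝓕⁻ χ s) * cexpTwoPi (-(s * x))) =
        (starRingEnd ℂ) (b s * 𝓕⁻ χ s) * (a x * (cexpTwoPi (-((t + s) * x)) * 𝓕 φ x)) := by
      intro x
      have : -((t + s) * (x : ℝ)) = -(t * x) + -(s * x) := by ring
      rw [this, cexpTwoPi_add]
      ring
    simp_rw [e]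
    rw [tsum_mul_left, hzero s, mul_zero]
  exact (tsum_congr h4).trans tsum_zero

/-- The measure on `Λ ∩ (Λ - h)` with masses `a x * 𝓕 φ x * conj (a (x + h))` has a spectral gap. -/
lemma IsDiscreteMeasure.spectrumVanishes_correlation (hμ : IsDiscreteMeasure μ Λ a)
    (hν : IsDiscreteMeasure (𝓕 μ) S b) {δ : ℝ} (hδ : 0 < δ)
    (hsep : ∀ x ∈ S, ∀ y ∈ S, x ≠ y → δ ≤ |x - y|) {φ : 𝓢(ℝ, ℂ)}
    (hφ : ∀ x, δ / 4 ≤ |x - δ / 2| → φ x = 0) (h : ℝ) :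
    SpectrumVanishes (Subtype.val : Λ → ℝ)
      (fun x => a x * 𝓕 φ x * (starRingEnd ℂ) (zeroExtend a (x + h))) (δ / 8) := by
  obtain ⟨d, hd, hsepΛ⟩ := hμ.uniformlyDiscrete
  obtain ⟨A, hA0, hA⟩ := hμ.exists_mass_bound hν
  obtain ⟨ε, χ, hεd, hεlim, hχ0, hχ1, hχs⟩ := exists_seq_schwartz_bump hd
  intro t ht
  have hlim : Tendsto (fun n => ∑' x : Λ, a x * (cexpTwoPi (-(-t * x)) * 𝓕 φ x) *
      (starRingEnd ℂ) (∑' y : Λ, a y * χ n (y - (x + h)))) atTop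
      (𝓝 (∑' x : Λ, a x * (cexpTwoPi (-(-t * x)) * 𝓕 φ x) *
        (starRingEnd ℂ) (zeroExtend a (x + h)))) := by
    refine tendsto_tsum_of_dominated_convergence ((hμ.summable_norm (𝓕 φ)).mul_right A)
      (fun x => ?_) (Eventually.of_forall fun n x => ?_)
    · refine Tendsto.const_mul _ ((Complex.continuous_conj.tendsto _).comp ?_)
      exact tendsto_tsum_bump hsepΛ hεd hεlim hχs hχ0 _ hd
    · rw [norm_mul, norm_mul, norm_mul, norm_cexpTwoPi, one_mul, RCLike.norm_conj, ← norm_mul]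
      gcongr
      exact norm_tsum_bump_le hsepΛ (hεd n) (hχs n) (hχ1 n) hA0 hA _
  have hzero : ∀ n, ∑' x : Λ, a x * (cexpTwoPi (-(-t * x)) * 𝓕 φ x) *
      (starRingEnd ℂ) (∑' y : Λ, a y * χ n (y - (x + h))) = 0 := by
    intro n
    have := hμ.tsum_correlation_eq_zero hν hδ hsep hφ (SchwartzMap.compSubConstCLM ℂ h (χ n))
      (t := -t) (by rwa [abs_neg])
    simpa only [SchwartzMap.compSubConstCLM_apply, sub_sub] using this
  simp_rw [hzero] at hlim
  have := tendsto_nhds_unique tendsto_const_nhds hlim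
  rw [this]
  refine tsum_congr fun x => ?_
  rw [neg_mul, neg_neg]
  ring

/-- All differences of the support of a measure with uniformly discrete support and spectrum
are dense. -/
theorem IsDiscreteMeasure.exists_hasDenseDifferences (hμ : IsDiscreteMeasure μ Λ a)
    (hν : IsDiscreteMeasure (𝓕 μ) S b) : ∃ c > 0, HasDenseDifferences Λ c := by
  obtain ⟨δ, hδ, hsep⟩ := hν.uniformlyDiscrete
  obtain ⟨d, hd, hsepΛ⟩ := hμ.uniformlyDiscrete
  obtain ⟨A, hA0, hA⟩ := hμ.exists_mass_bound hν
  -- Fixed before `x₀`, `y₀` and `φ`: the constant depends only on `d` and `δ`, so it serves all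
  -- differences at once. Halving it absorbs the change of centre from `x₀` to the origin.
  obtain ⟨c, hc, hdens⟩ := exists_density_of_spectrumVanishes hd (by positivity : 0 < δ / 8)
  refine ⟨c / 2, by positivity, fun x₀ hx₀ y₀ hy₀ => ?_⟩
  set h := y₀ - x₀ with hh
  obtain ⟨φ, hφ, hφx⟩ := exists_schwartz_fourier_ne_zero (by positivity : 0 < δ / 4) (δ / 2) x₀
  let Λ' : Set ℝ := {x | x ∈ Λ ∧ x + h ∈ Λ}
  have hsub : Λ' ⊆ Λ := fun x hx => hx.1
  obtain ⟨W, hWdef⟩ : ∃ W : ℝ → ℂ, ∀ x, W x =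
      zeroExtend a x * 𝓕 φ x * (starRingEnd ℂ) (zeroExtend a (x + h)) := ⟨_, fun _ => rfl⟩
  have hWΛ : ∀ x : Λ, W x = a x * 𝓕 φ x * (starRingEnd ℂ) (zeroExtend a (x + h)) := fun x => by
    rw [hWdef, zeroExtend_apply]
  have hWsupp : ∀ x, x ∉ Λ' → W x = 0 := by
    intro x hx
    rw [hWdef]
    by_cases hxΛ : x ∈ Λ
    · have : x + h ∉ Λ := fun h' => hx ⟨hxΛ, h'⟩
      rw [zeroExtend_of_notMem a this, map_zero, mul_zero]
    · rw [zeroExtend_of_notMem a hxΛ, zero_mul, zero_mul]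
  have hext : ∀ x, ‖zeroExtend a x‖ ≤ A := by
    intro x
    by_cases hx : x ∈ Λ
    · exact (zeroExtend_apply a ⟨x, hx⟩) ▸ hA ⟨x, hx⟩
    · rw [zeroExtend_of_notMem a hx, norm_zero]; exact hA0
  have hsumΛ : Summable fun x : Λ => ‖W x‖ := by
    have h1 : ∀ x : Λ, ‖(starRingEnd ℂ) (zeroExtend a (x + h))‖ ≤ A := fun x => by
      rw [RCLike.norm_conj]; exact hext _
    have h2 := Summable.mul_of_norm_le (hμ.summable_norm (𝓕 φ)) h1
    exact h2.congr fun x => by rw [hWΛ]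
  have hsum : Summable fun x : Λ' => ‖W x‖ :=
    (hsumΛ.comp_injective (Set.inclusion_injective hsub)).congr fun x => rfl
  have hvan : SpectrumVanishes (Subtype.val : Λ' → ℝ) (fun x => W x) (δ / 8) := by
    refine SpectrumVanishes.restrict hsub hWsupp ?_
    simp_rw [hWΛ]
    exact hμ.spectrumVanishes_correlation hν hδ hsep hφ h
  have hx₀' : x₀ ∈ Λ' := ⟨hx₀, by rw [hh, add_sub_cancel]; exact hy₀⟩
  have hW0 : W x₀ ≠ 0 := by
    have h1 : zeroExtend a x₀ ≠ 0 := by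
      rw [zeroExtend_apply a ⟨x₀, hx₀⟩]; exact hμ.mass_ne_zero _
    have h2 : zeroExtend a (x₀ + h) ≠ 0 := by
      rw [zeroExtend_apply a ⟨x₀ + h, hx₀'.2⟩]; exact hμ.mass_ne_zero _
    rw [hWdef]
    exact mul_ne_zero (mul_ne_zero h1 hφx) ((map_ne_zero _).2 h2)
  have hfin : ∀ y R, (Λ' ∩ Set.Icc (y - R) (y + R)).Finite := by
    intro y R
    refine (hμ.uniformlyDiscrete.translationBounded.finite_inter one_pos (|y| + R)).subset ?_
    rintro x ⟨hx, hx1, hx2⟩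
    have := abs_le.1 (le_refl |y|)
    exact ⟨hsub hx, by linarith [this.1], by linarith [this.2]⟩
  have hev := hdens Λ' (hμ.uniformlyDiscrete.countable.mono hsub)
    (fun x hx y hy => hsepΛ x hx.1 y hy.1) hfin (fun x => W x) hsum hvan ⟨x₀, hx₀'⟩ hW0
  have hev' := (tendsto_atTop_add_const_right atTop (-|x₀|) tendsto_id).eventually hev
  filter_upwards [hev', eventually_ge_atTop (2 * |x₀|)] with R ⟨s, hs, hsc⟩ hR
  refine ⟨s, fun z hz => ?_, ?_⟩
  · obtain ⟨⟨h1, h2⟩, h3⟩ := hs z hz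
    refine ⟨h1, h2, ?_⟩
    have h4 : |z| ≤ |z - x₀| + |x₀| := by simpa using abs_add_le (z - x₀) x₀
    simp only [id] at h3
    linarith
  · refine le_trans ?_ hsc
    simp only [id]
    nlinarith

end Correlation

/-! ### The spectrum from a linear recurrence -/

/-- If every point of `S` can be moved in both directions by one of `β, …, n β` without leaving `S`,
then modulo `β` every point of `S` is congruent to a point of `S ∩ [0, n β]`. -/
lemma exists_add_int_mul_mem_Icc {S : Set ℝ} {β : ℝ} (hβ : 0 < β) {n : ℕ}
    (hadd : ∀ s ∈ S, ∃ j : ℕ, 1 ≤ j ∧ j ≤ n ∧ s + j * β ∈ S)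
    (hsub : ∀ s ∈ S, ∃ j : ℕ, 1 ≤ j ∧ j ≤ n ∧ s - j * β ∈ S) {s : ℝ} (hs : s ∈ S) :
    ∃ k : ℤ, s + k * β ∈ S ∩ Set.Icc 0 (n * β) := by
  -- Moving towards the window changes `s` by between `β` and `n * β`, so it cannot jump over the
  -- window and the bound on `|s|` drops by `β`.
  have key : ∀ m : ℕ, ∀ s ∈ S, |s| ≤ m * β → ∃ k : ℤ, s + k * β ∈ S ∩ Set.Icc 0 (n * β) := by
    intro m
    induction m with
    | zero =>
      intro s hs hm
      have h0 : s = 0 := abs_nonpos_iff.1 (by simpa using hm)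
      exact ⟨0, by simpa [h0] using h0 ▸ hs, by simp [h0], by simp [h0]; positivity⟩
    | succ m ih =>
      intro s hs hm
      push_cast at hm
      have hm' := abs_le.1 hm
      rcases lt_or_ge s 0 with h0 | h0
      · obtain ⟨j, hj1, hjn, hj⟩ := hadd s hs
        have h1 : β ≤ j * β := le_mul_of_one_le_left hβ.le (by exact_mod_cast hj1)
        have h2 : j * β ≤ n * β := by gcongr
        rcases le_or_gt 0 (s + j * β) with h3 | h3
        · exact ⟨j, by simpa using hj, by simpa using h3, by push_cast; linarith⟩
        · obtain ⟨k, hk⟩ := ih _ hj (by rw [abs_of_neg h3]; linarith)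
          exact ⟨j + k, by push_cast; rwa [add_mul, ← add_assoc]⟩
      · rcases le_or_gt s (n * β) with h3 | h3
        · exact ⟨0, by simpa using hs, by simpa using h0, by simpa using h3⟩
        · obtain ⟨j, hj1, hjn, hj⟩ := hsub s hs
          have h1 : β ≤ j * β := le_mul_of_one_le_left hβ.le (by exact_mod_cast hj1)
          have h2 : j * β ≤ n * β := by gcongr
          obtain ⟨k, hk⟩ := ih _ hj (by rw [abs_of_nonneg (by linarith)]; linarith)
          refine ⟨k - j, ?_⟩
          push_cast
          rwa [sub_mul, add_sub, add_sub_right_comm]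
  obtain ⟨m, hm⟩ := exists_nat_ge (|s| / β)
  exact key m s hs ((div_le_iff₀ hβ).1 hm)

section Recurrence

variable {μ : 𝓢'(ℝ, ℂ)} {Λ S : Set ℝ} {a : Λ → ℂ} {b : S → ℂ}

/-- A polynomial vanishing at the points `exp (2 π i β x)`, `x ∈ Λ`, is a linear recurrence with step
`β` for the Fourier transform of a measure supported on `Λ`. -/
lemma IsDiscreteMeasure.sum_coeff_mul_fourier_eq_zero (hμ : IsDiscreteMeasure μ Λ a)
    (hν : IsDiscreteMeasure (𝓕 μ) S b) {β : ℝ} {p : Polynomial ℂ}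
    (hp : ∀ x ∈ Λ, p.eval (cexpTwoPi (β * x)) = 0) (y : ℝ) :
    ∑ j ∈ Finset.range (p.natDegree + 1), p.coeff j * zeroExtend b (y - j * β) = 0 := by
  obtain ⟨d, hd, hsep⟩ := hν.uniformlyDiscrete
  obtain ⟨ε, χ, hεd, hεlim, hχ0, _, hχs⟩ := exists_seq_schwartz_bump hd
  have hlim : Tendsto (fun n => ∑ j ∈ Finset.range (p.natDegree + 1),
      p.coeff j * ∑' s : S, b s * χ n (s - (y - j * β))) atTop
      (𝓝 (∑ j ∈ Finset.range (p.natDegree + 1), p.coeff j * zeroExtend b (y - j * β))) :=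
    tendsto_finsetSum _ fun j _ =>
      (tendsto_tsum_bump hsep hεd hεlim hχs hχ0 _ hd).const_mul _
  have hzero : ∀ n, ∑ j ∈ Finset.range (p.natDegree + 1),
      p.coeff j * ∑' s : S, b s * χ n (s - (y - j * β)) = 0 := by
    intro n
    have hs : ∀ t : ℝ, Summable fun x : Λ => a x * (cexpTwoPi (-(t * x)) * 𝓕 (χ n) x) := fun t =>
      Summable.of_norm ((hμ.summable_norm (𝓕 (χ n))).congr fun x => by simp)
    simp_rw [hμ.tsum_eq_tsum_fourier hν, ← tsum_mul_left]
    rw [← Summable.tsum_finsetSum fun j _ => (hs _).mul_left _]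
    have h0 : ∀ x : Λ, ∑ j ∈ Finset.range (p.natDegree + 1),
        p.coeff j * (a x * (cexpTwoPi (-((y - j * β) * x)) * 𝓕 (χ n) x)) = 0 := by
      intro x
      have hx := hp x x.2
      rw [Polynomial.eval_eq_sum_range] at hx
      calc _ = a x * cexpTwoPi (-(y * x)) * 𝓕 (χ n) x *
          ∑ j ∈ Finset.range (p.natDegree + 1), p.coeff j * cexpTwoPi (β * x) ^ j := by
            rw [Finset.mul_sum]
            refine Finset.sum_congr rfl fun j _ => ?_
            have e : -((y - j * β) * (x : ℝ)) = -(y * x) + j * (β * x) := by ring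
            rw [e, cexpTwoPi_add, cexpTwoPi_nat_mul]
            ring
        _ = 0 := by rw [hx, mul_zero]
    exact (tsum_congr h0).trans tsum_zero
  simp_rw [hzero] at hlim
  exact (tendsto_nhds_unique tendsto_const_nhds hlim).symm

/-- If `Λ` is contained in finitely many translates of `α ℤ`, then `S` is contained in finitely many
translates of `α⁻¹ ℤ`. -/
lemma IsDiscreteMeasure.exists_finite_fourier (hμ : IsDiscreteMeasure μ Λ a)
    (hν : IsDiscreteMeasure (𝓕 μ) S b) {α : ℝ} (hα : 0 < α) {F : Set ℝ} (hF : F.Finite)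
    (hΛ : ∀ x ∈ Λ, ∃ k : ℤ, ∃ f ∈ F, x = k * α + f) :
    ∃ G : Set ℝ, G.Finite ∧ ∀ s ∈ S, ∃ k : ℤ, ∃ g ∈ G, s = k * α⁻¹ + g := by
  -- Adding a multiple of `α` to `x` does not change `exp (2πi x / α)`, so these roots cover all
  -- values on `Λ`. They are nonzero, so both extreme coefficients of `p` are nonzero and the
  -- recurrence can be used in both directions.
  let p : Polynomial ℂ :=
    ∏ f ∈ hF.toFinset, (Polynomial.X - Polynomial.C (cexpTwoPi (α⁻¹ * f)))
  have hpm : p.Monic := Polynomial.monic_prod_of_monic _ _ fun f _ => Polynomial.monic_X_sub_C _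
  have hp0 : p.coeff 0 ≠ 0 := by
    rw [Polynomial.coeff_zero_eq_eval_zero, Polynomial.eval_prod, Finset.prod_ne_zero_iff]
    intro f _
    simpa using cexpTwoPi_ne_zero _
  have hp : ∀ x ∈ Λ, p.eval (cexpTwoPi (α⁻¹ * x)) = 0 := by
    intro x hx
    obtain ⟨k, f, hf, rfl⟩ := hΛ x hx
    rw [Polynomial.eval_prod]
    refine Finset.prod_eq_zero (hF.mem_toFinset.2 hf) ?_
    have e : α⁻¹ * (k * α + f) = k + α⁻¹ * f := by field_simp
    rw [e, cexpTwoPi_add, cexpTwoPi_int, one_mul]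
    simp
  have hrec := hμ.sum_coeff_mul_fourier_eq_zero hν hp
  have hmass : ∀ s ∈ S, zeroExtend b s ≠ 0 := fun s hs => by
    rw [zeroExtend_apply b ⟨s, hs⟩]
    exact hν.mass_ne_zero _
  have hsub : ∀ s ∈ S, ∃ j : ℕ, 1 ≤ j ∧ j ≤ p.natDegree ∧ s - j * α⁻¹ ∈ S := by
    intro s hs
    by_contra! h
    have h1 := hrec s
    rw [Finset.sum_eq_single 0 (fun j hj hj0 => ?_) (by simp)] at h1
    · refine mul_ne_zero hp0 (hmass s hs) ?_
      simpa using h1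
    · rw [Finset.mem_range] at hj
      rw [zeroExtend_of_notMem b (h j (by omega) (by omega)), mul_zero]
  have hadd : ∀ s ∈ S, ∃ j : ℕ, 1 ≤ j ∧ j ≤ p.natDegree ∧ s + j * α⁻¹ ∈ S := by
    intro s hs
    by_contra! h
    -- At this base point the leading term is the mass at `s`, and the others sit at larger points.
    have h1 := hrec (s + p.natDegree * α⁻¹)
    rw [Finset.sum_eq_single p.natDegree (fun j hj hj0 => ?_) (by simp)] at h1
    · rw [hpm.coeff_natDegree, one_mul, add_sub_cancel_right] at h1
      exact hmass s hs h1
    · rw [Finset.mem_range] at hj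
      have h2 := h (p.natDegree - j) (by omega) (by omega)
      rw [Nat.cast_sub (by omega), sub_mul, add_sub] at h2
      rw [zeroExtend_of_notMem b h2, mul_zero]
  refine ⟨S ∩ Set.Icc 0 (p.natDegree * α⁻¹), ?_, fun s hs => ?_⟩
  · refine (hν.uniformlyDiscrete.translationBounded.finite_inter one_pos
      (p.natDegree * α⁻¹)).subset (Set.inter_subset_inter_right _ (Set.Icc_subset_Icc_left ?_))
    have : 0 ≤ p.natDegree * α⁻¹ := by positivity
    linarith
  · obtain ⟨k, hk⟩ := exists_add_int_mul_mem_Icc (inv_pos.2 hα) hadd hsub hs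
    exact ⟨-k, _, hk, by push_cast; ring⟩

/-- The support of a measure with uniformly discrete support and spectrum is contained in finitely
many translates of a lattice. -/
lemma IsDiscreteMeasure.exists_finite_support (hμ : IsDiscreteMeasure μ Λ a)
    (hν : IsDiscreteMeasure (𝓕 μ) S b) : ∃ α : ℝ, 0 < α ∧ ∃ F : Set ℝ, F.Finite ∧
      ∀ x ∈ Λ, ∃ k : ℤ, ∃ f ∈ F, x = k * α + f := by
  -- The empty set is not relatively dense and is treated apart.
  rcases Λ.eq_empty_or_nonempty with rfl | hne
  · exact ⟨1, one_pos, ∅, Set.finite_empty, fun x hx => hx.elim⟩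
  obtain ⟨c, hc, hdiff⟩ := hμ.exists_hasDenseDifferences hν
  obtain ⟨R, hR⟩ := hμ.exists_isRelativelyDense hν hne
  obtain ⟨α, hα, F, hF, h⟩ := hdiff.exists_lattice hc hμ.uniformlyDiscrete hR
  refine ⟨|α|, abs_pos.2 hα, F, hF, fun x hx => ?_⟩
  obtain ⟨k, f, hf, rfl⟩ := h x hx
  rcases abs_choice α with h | h <;> rw [h]
  · exact ⟨k, f, hf, rfl⟩
  · exact ⟨-k, f, hf, by push_cast; ring⟩

end Recurrence

/-! ### The lattice generated by `α` and its dual -/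

lemma discreteTopology_span_singleton (α : ℝ) :
    DiscreteTopology (Submodule.span ℤ {α}) := by
  refine (inferInstance : DiscreteTopology (AddSubgroup.zmultiples α)).of_subset ?_
  intro x hx
  obtain ⟨k, rfl⟩ := Submodule.mem_span_singleton.1 hx
  exact AddSubgroup.zsmul_mem_zmultiples α k

lemma isZLattice_span_singleton {α : ℝ} (hα : 0 < α) [DiscreteTopology (Submodule.span ℤ {α})] :
    IsZLattice ℝ (Submodule.span ℤ {α}) := by
  refine ⟨eq_top_iff.2 fun x _ => ?_⟩
  have h := Submodule.smul_mem (Submodule.span ℝ (Submodule.span ℤ {α} : Set ℝ)) (x / α)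
    (Submodule.subset_span (Submodule.mem_span_singleton_self α))
  rwa [smul_eq_mul, div_mul_cancel₀ x hα.ne'] at h

theorem theorem1 (Λ S : Set ℝ) (a : Λ → ℂ) (b : S → ℂ) (μ : 𝓢'(ℝ, ℂ))
    (hμ : IsDiscreteMeasure μ Λ a) (hμ_fourier : IsDiscreteMeasure (𝓕 μ) S b) :
    ∃ (L : Submodule ℤ ℝ) (_ : DiscreteTopology L) (_ : IsZLattice ℝ L) (F G : Set ℝ),
      F.Finite ∧ G.Finite ∧ Λ ⊆ (L : Set ℝ) + F ∧ S ⊆ (dualLattice L : Set ℝ) + G := by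
  obtain ⟨α, hα, F, hF, hΛ⟩ := hμ.exists_finite_support hμ_fourier
  obtain ⟨G, hG, hS⟩ := hμ.exists_finite_fourier hμ_fourier hα hF hΛ
  have hL := discreteTopology_span_singleton α
  refine ⟨Submodule.span ℤ {α}, hL, isZLattice_span_singleton hα, F, G, hF, hG, ?_, ?_⟩
  · intro x hx
    obtain ⟨k, f, hf, rfl⟩ := hΛ x hx
    exact Set.add_mem_add (Submodule.mem_span_singleton.2 ⟨k, zsmul_eq_mul α k⟩) hf
  · intro s hs
    obtain ⟨k, g, hg, rfl⟩ := hS s hs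
    refine Set.add_mem_add (fun x hx => ?_) hg
    obtain ⟨m, rfl⟩ := Submodule.mem_span_singleton.1 hx
    refine ⟨m * k, ?_⟩
    rw [zsmul_eq_mul]
    push_cast
    field_simp
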